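/- Let $0<\delta\le 1$ and let $z,h:\mathbb R\to\mathbb R^2$ be curves of class $C^{2,\delta}$ that are horizontally periodic, $z(\alpha+2\pi)=z(\alpha)+(2\pi,0)$ and $h(\alpha+2\pi)=h(\alpha)+(2\pi,0)$. Put $$\mathcal F(z)(\alpha,\beta)=\frac{|\beta|^2}{|z(\alpha)-z(\alpha-\beta)|^2}\ (\beta\ne0),\qquad \mathcal F(z)(\alpha,0)=\frac1{|\partial_\alpha z(\alpha)|^2},\qquad d(z,h)(\alpha,\beta)=\frac1{|z(\alpha)-h(\alpha-\beta)|^2}$$ (with value $+\infty$ where a denominator vanishes), let $\|\cdot\|_{L^\infty}$ be the supremum over $\alpha,\beta\in\mathbb R$, and let $$\|z\|_{C^{2,\delta}}=\sup_{[-\pi,\pi]}|z|+\sup|\partial_\alpha z|+\sup|\partial^2_\alpha z|+\sup_{\alpha\ne\beta}\frac{|\partial_\alpha^2z(\alpha)-\partial_\alpha^2z(\beta)|}{|\alpha-\beta|^\delta}.$$ With $(x_1,x_2)^\perp=(-x_2,x_1)$, for curves $x,y\in\{z,h\}$ and a $2\pi$-periodic $u\in L^2(\mathbb T)$, $\mathbb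 T=\mathbb R/2\pi\mathbb Z$, let $$2BR(u,y)_x(\alpha)\cdot\partial_\alpha x(\alpha)=\frac1\pi\,PV\!\int_{\mathbb R}\frac{(x(\alpha)-y(\alpha-\beta))^\perp\cdot\partial_\alpha x(\alpha)}{|x(\alpha)-y(\alpha-\beta)|^2}\,u(\alpha-\beta)\,d\beta ,$$ where $PV\int_{\mathbb R}$ is the limit of the integral over $\varepsilon<|\beta|<R$ as $\varepsilon\to0^+$, $R\to\infty$. Let $T_1u=2BR(u,z)_z\cdot\partial_\alpha z$, $T_2u=2BR(u,h)_z\cdot\partial_\alpha z$, $T_3u=2BR(u,z)_h\cdot\partial_\alpha h$, $T_4u=2BR(u,h)_h\cdot\partial_\alpha h$ and $\mathcal T(u,v)=(T_1u+T_2v,\;T_3u+T_4v)$. Pairs carry the norm $\|(u,v)\|=\|u\|+\|v\|$. Suppose that $\|\mathcal F(z)\|_{L^\infty}<\infty$, $\|\mathcal F(h)\|_{L^\infty}<\infty$ and $\|d(z,h)\|_{L^\infty}<\infty$. Then the principal values exist for every $u\in L^2(\mathbb T)$ and every $\alpha$, the operator $\mathcal T:L^2(\mathbb T)\times L^2(\mathbb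 T)\to H^1(\mathbb T)\times H^1(\mathbb T)$ is well defined, bounded and compact, and $$\|\mathcal T\|_{L^2\times L^2\to H^1\times H^1}\le C\,\|\mathcal F(z)\|_{L^\infty}^2\,\max\{1,\|d(z,h)\|_{L^\infty}\}^2\,\|z\|_{C^{2,\delta}}^4 ,$$ where $C$ depends only on $\delta$ and on the fixed curve $h$, not on $z$. In particular $\|\mathcal T\|\le C\|\mathcal F(z)\|_{L^\infty}^2\|d(z,h)\|_{L^\infty}^2\|z\|_{C^{2,\delta}}^4$ whenever $\|d(z,h)\|_{L^\infty}\ge1$, i.e. whenever the distance between the curves is at most $1$. -/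

import Mathlib

open Real Filter Topology MeasureTheory
open scoped NNReal ENNReal ContDiff

noncomputable section

namespace BirkhoffRott

instance fact_two_pi_pos : Fact (0 < 2 * π) := ⟨Real.two_pi_pos⟩

/-! ### Curves

The plane is identified with `ℂ`, so that `x · y` is `inner ℝ x y` and
`(x₁, x₂)^⊥ = (-x₂, x₁)` is multiplication by `I`. -/

/-- Rotation by a right angle, `(x₁, x₂)^⊥ = (-x₂, x₁)`. -/
def perp (x : ℂ) : ℂ := Complex.I * x

/-- A horizontally `2π`-periodic parametrized curve, `z(α + 2π) = z(α) + (2π, 0)`,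
of class `C^{2,δ}`. -/
structure IsC2HolderCurve (δ : ℝ≥0) (z : ℝ → ℂ) : Prop where
  periodic : ∀ α, z (α + 2 * π) = z α + 2 * π
  contDiff : ContDiff ℝ 2 z
  holder : MemHolder δ (deriv (deriv z))

/-- The `C^{2,δ}` norm of a periodic curve. Only the curve itself is unbounded on `ℝ`; it is
measured on one period. -/
def c2HolderNorm (δ : ℝ≥0) (z : ℝ → ℂ) : ℝ≥0∞ :=
  (⨆ α ∈ Set.Icc (-π) π, ‖z α‖ₑ) + (⨆ α, ‖deriv z α‖ₑ) + (⨆ α, ‖deriv (deriv z) α‖ₑ)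
    + eHolderNorm δ (deriv (deriv z))

/-- The arc-chord function `F(z)(α, β) = |β|² / |z(α) - z(α - β)|²`, with
`F(z)(α, 0) = 1 / |∂_α z(α)|²`. It is `∞` where a denominator vanishes. -/
def arcChord (z : ℝ → ℂ) (α β : ℝ) : ℝ≥0∞ :=
  if β = 0 then (‖deriv z α‖ₑ ^ 2)⁻¹ else ‖β‖ₑ ^ 2 / ‖z α - z (α - β)‖ₑ ^ 2

/-- `‖F(z)‖_{L^∞}`. -/
def arcChordNorm (z : ℝ → ℂ) : ℝ≥0∞ := ⨆ α, ⨆ β, arcChord z α β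

/-- `‖d(z, h)‖_{L^∞}` for `d(z, h)(α, β) = 1 / |z(α) - h(α - β)|²` (`∞` if the curves touch). -/
def distNorm (z h : ℝ → ℂ) : ℝ≥0∞ := ⨆ α, ⨆ β, (‖z α - h (α - β)‖ₑ ^ 2)⁻¹

/-! ### Function spaces on the circle `𝕋 = ℝ / 2πℤ` -/

/-- `L²(𝕋)`, real valued. -/
abbrev L2 : Type := Lp ℝ 2 (volume : Measure (AddCircle (2 * π)))

/-- `g` is the weak derivative of `f` on the circle: `∫ f φ' = - ∫ g φ` for all smooth `φ`
(`ψ` is the derivative of `φ`). -/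
def IsWeakDeriv (f g : L2) : Prop :=
  ∀ φ ψ : C(AddCircle (2 * π), ℝ), ContDiff ℝ ∞ (fun t : ℝ => φ t) →
    (∀ t : ℝ, HasDerivAt (fun s : ℝ => φ s) (ψ t) t) →
    ∫ x, f x * ψ x = - ∫ x, g x * φ x

theorem integrable_mul_continuousMap (f : L2) (φ : C(AddCircle (2 * π), ℝ)) :
    Integrable (fun x => f x * φ x) (volume : Measure (AddCircle (2 * π))) := by
  have h1 : Integrable f (volume : Measure (AddCircle (2 * π))) :=
    (Lp.memLp f).integrable (by norm_num)
  exact h1.mul_bdd (c := ‖φ‖) φ.continuous.aestronglyMeasurable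
    (Filter.Eventually.of_forall fun x => φ.norm_coe_le_norm x)

theorem integral_add_mul (f g : L2) (φ : C(AddCircle (2 * π), ℝ)) :
    ∫ x, (f + g : L2) x * φ x = (∫ x, f x * φ x) + ∫ x, g x * φ x := by
  rw [← integral_add (integrable_mul_continuousMap f φ) (integrable_mul_continuousMap g φ)]
  refine integral_congr_ae ?_
  filter_upwards [Lp.coeFn_add f g] with x hx
  rw [hx, Pi.add_apply, add_mul]

theorem integral_smul_mul (c : ℝ) (f : L2) (φ : C(AddCircle (2 * π), ℝ)) :
    ∫ x, (c • f : L2) x * φ x = c * ∫ x, f x * φ x := by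
  rw [← integral_const_mul]
  refine integral_congr_ae ?_
  filter_upwards [Lp.coeFn_smul c f] with x hx
  rw [hx, Pi.smul_apply, smul_eq_mul, mul_assoc]

/-- The Sobolev space `H¹(𝕋)`: pairs `(f, ∂f)` of an `L²` function and its `L²` weak derivative,
with the norm `(‖f‖² + ‖∂f‖²)^{1/2}`. -/
def H1 : Submodule ℝ (WithLp 2 (L2 × L2)) where
  carrier := {p | IsWeakDeriv p.fst p.snd}
  zero_mem' := by
    intro φ ψ _ _
    have h : ∀ χ : C(AddCircle (2 * π), ℝ), ∫ x, (0 : L2) x * χ x = 0 := by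
      intro χ
      have := integral_smul_mul 0 (0 : L2) χ
      simpa only [zero_smul, zero_mul] using this
    rw [WithLp.zero_fst, WithLp.zero_snd, h ψ, h φ, neg_zero]
  add_mem' := by
    intro p q hp hq φ ψ hφ hψ
    rw [WithLp.add_fst, WithLp.add_snd, integral_add_mul, integral_add_mul,
      hp φ ψ hφ hψ, hq φ ψ hφ hψ]
    ring
  smul_mem' := by
    intro c p hp φ ψ hφ hψ
    rw [WithLp.smul_fst, WithLp.smul_snd, integral_smul_mul, integral_smul_mul, hp φ ψ hφ hψ]
    ring

/-- The `L²` function underlying an element of `H¹`. -/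
def H1.toL2 (f : H1) : L2 := (f : WithLp 2 (L2 × L2)).fst

/-- `L² × L²` with the norm `‖(u, v)‖ = ‖u‖ + ‖v‖`. -/
abbrev L2Pair : Type := WithLp 1 (L2 × L2)

/-- `H¹ × H¹` with the norm `‖(u, v)‖ = ‖u‖ + ‖v‖`. -/
abbrev H1Pair : Type := WithLp 1 (H1 × H1)

/-! ### Principal values and the operators -/

section PrincipalValue

variable {E : Type*} [NormedAddCommGroup E] [NormedSpace ℝ E]

/-- `PV ∫_ℝ f(β) dβ = a`: the limit over `ε < |β| < R`, as `ε → 0⁺` and `R → ∞`. -/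
def HasPV (f : ℝ → E) (a : E) : Prop :=
  (∀ ε R : ℝ, 0 < ε → IntegrableOn f {β | ε < |β| ∧ |β| < R}) ∧
  Tendsto (fun p : ℝ × ℝ => ∫ β in {β | p.1 < |β| ∧ |β| < p.2}, f β)
    (𝓝[>] 0 ×ˢ atTop) (𝓝 a)

open Classical in
/-- The value of `PV ∫_ℝ f(β) dβ` (zero if it does not exist). -/
def pv (f : ℝ → E) : E := if h : ∃ a, HasPV f a then h.choose else 0

theorem HasPV.pv_eq {f : ℝ → E} {a : E} (h : HasPV f a) : pv f = a := by
  have hex : ∃ a, HasPV f a := ⟨a, h⟩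
  rw [pv, dif_pos hex]
  exact tendsto_nhds_unique hex.choose_spec.2 h.2

end PrincipalValue

/-- The integrand `(x(α) - y(α-β))^⊥ / |x(α) - y(α-β)|² u(α-β)` of the Birkhoff–Rott integral
along the curve `y`, evaluated on the curve `x`. -/
def brIntegrand (y x : ℝ → ℂ) (u : L2) (α β : ℝ) : ℂ :=
  (u ((α - β : ℝ) : AddCircle (2 * π)) / ‖x α - y (α - β)‖ ^ 2) • perp (x α - y (α - β))

/-- The integrand of `2 BR(u, y)_x(α) · ∂_α x(α)`, up to the factor `1/π`. -/
def tangentialIntegrand (y x : ℝ → ℂ) (u : L2) (α β : ℝ) : ℝ :=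
  inner ℝ (brIntegrand y x u α β) (deriv x α)

/-- The Birkhoff–Rott integral
`BR(u, y)_x(α) = (1/2π) PV ∫ (x(α) - y(β))^⊥ / |x(α) - y(β)|² u(β) dβ`. -/
def BR (u : L2) (y x : ℝ → ℂ) (α : ℝ) : ℂ :=
  (1 / (2 * π)) • pv (brIntegrand y x u α)

/-- `2 BR(u, y)_x(α) · ∂_α x(α)`, that is
`(1/π) PV ∫ (x(α) - y(β))^⊥ · ∂_α x(α) / |x(α) - y(β)|² u(β) dβ`. The scalar product stands
inside the principal value; see `tangentialBR_eq` for the comparison with `BR`. -/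
def tangentialBR (y x : ℝ → ℂ) (u : L2) (α : ℝ) : ℝ :=
  (1 / π) * pv (tangentialIntegrand y x u α)

/-- Wherever the vector-valued principal value exists, `tangentialBR` is `2 BR · ∂_α x`. -/
theorem tangentialBR_eq (y x : ℝ → ℂ) (u : L2) (α : ℝ)
    (h : ∃ a, HasPV (brIntegrand y x u α) a) :
    tangentialBR y x u α = inner ℝ ((2 : ℝ) • BR u y x α) (deriv x α) := by
  obtain ⟨a, ha⟩ := h
  have hL : HasPV (tangentialIntegrand y x u α) (inner ℝ a (deriv x α)) := by
    have key : tangentialIntegrand y x u α =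
        fun β => innerSL ℝ (deriv x α) (brIntegrand y x u α β) := by
      funext β
      simp only [tangentialIntegrand, innerSL_apply_apply, real_inner_comm]
    refine ⟨fun ε R hε => ?_, ?_⟩
    · rw [key]
      exact (innerSL ℝ (deriv x α)).integrable_comp (ha.1 ε R hε)
    · have h2 := ((innerSL ℝ (deriv x α)).continuous.tendsto a).comp ha.2
      rw [innerSL_apply_apply, real_inner_comm] at h2
      refine h2.congr' ?_
      have hpos : ∀ᶠ p : ℝ × ℝ in 𝓝[>] (0 : ℝ) ×ˢ (atTop : Filter ℝ), 0 < p.1 :=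
        tendsto_fst.eventually self_mem_nhdsWithin
      filter_upwards [hpos] with p hp
      rw [key]
      exact ((innerSL ℝ (deriv x α)).integral_comp_comm (ha.1 p.1 p.2 hp)).symm
  rw [tangentialBR, hL.pv_eq, BR, ha.pv_eq, smul_smul, real_inner_smul_left]
  congr 1
  field_simp

/-- `T₁(u) = 2 BR(u, z)_z · ∂_α z`. -/
def T₁ (z : ℝ → ℂ) : L2 → ℝ → ℝ := tangentialBR z z

/-- `T₂(v) = 2 BR(v, h)_z · ∂_α z`. -/
def T₂ (z h : ℝ → ℂ) : L2 → ℝ → ℝ := tangentialBR h z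

/-- `T₃(u) = 2 BR(u, z)_h · ∂_α h`. -/
def T₃ (z h : ℝ → ℂ) : L2 → ℝ → ℝ := tangentialBR z h

/-- `T₄(v) = 2 BR(v, h)_h · ∂_α h`. -/
def T₄ (h : ℝ → ℂ) : L2 → ℝ → ℝ := tangentialBR h h

/-- All four principal values in `T₁, …, T₄` exist, for every density and at every point. -/
def OperatorsDefined (z h : ℝ → ℂ) : Prop :=
  ∀ (u : L2) (α : ℝ),
    (∃ a, HasPV (tangentialIntegrand z z u α) a) ∧ (∃ a, HasPV (tangentialIntegrand h z u α) a) ∧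
    (∃ a, HasPV (tangentialIntegrand z h u α) a) ∧ (∃ a, HasPV (tangentialIntegrand h h u α) a)

/-- The bounded operator `S : L² × L² → H¹ × H¹` is the matrix operator
`(u, v) ↦ (T₁ u + T₂ v, T₃ u + T₄ v)`. -/
def IsMatrixOperator (z h : ℝ → ℂ) (S : L2Pair →L[ℝ] H1Pair) : Prop :=
  ∀ w : L2Pair, ∀ᵐ α : ℝ,
    H1.toL2 (S w).fst (α : AddCircle (2 * π)) = T₁ z w.fst α + T₂ z h w.snd α ∧
    H1.toL2 (S w).snd (α : AddCircle (2 * π)) = T₃ z h w.fst α + T₄ h w.snd α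

end BirkhoffRott

end

/-!
Summing over the periods turns the Cauchy kernel `1 / w` into `½ cot (w / 2)`, so that on one
period the operator of `y` on `x` has the kernel `Im (∂x(α) · ½ cot ((x(α) - y(γ)) / 2))`. If
`x = y`, then `∂x(α) / (x(α) - x(γ)) = 1 / (α - γ) + O(1)`, and the singular term is real: taking
the tangential component leaves a bounded kernel without a jump on the diagonal, whose derivative in
`α` is `O(|α - γ| ^ (δ - 1))`, hence integrable. The same bounds are immediate for separated
curves. Schur's test, applied to the kernel and to its derivative, bounds the operators from `L²`
to `H¹`, and cutting the kernels off near the diagonal, where they contribute little to Schur's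
test, approximates them in norm by compact operators with continuous kernels.
-/

namespace BirkhoffRott

/-! ### Schur kernels -/

section Schur

variable {X : Type*} [MeasurableSpace X] {μ : Measure X}

theorem lintegral_mul_sq_le {f g : X → ℝ≥0∞} (hf : AEMeasurable f μ) (hg : AEMeasurable g μ) :
    (∫⁻ a, f a * g a ∂μ) ^ 2 ≤ (∫⁻ a, f a ∂μ) * ∫⁻ a, f a * g a ^ 2 ∂μ := by
  have hhalf (t : ℝ≥0∞) : (t ^ (1 / 2 : ℝ)) ^ 2 = t := by
    rw [← ENNReal.rpow_natCast, ← ENNReal.rpow_mul]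
    norm_num
  have hsqrt (t : ℝ≥0∞) : (t ^ 2) ^ (1 / 2 : ℝ) = t := by
    rw [← ENNReal.rpow_natCast, ← ENNReal.rpow_mul]
    norm_num
  have hprod (a : X) : f a ^ (1 / 2 : ℝ) * (f a * g a ^ 2) ^ (1 / 2 : ℝ) = f a * g a := by
    rw [← ENNReal.mul_rpow_of_nonneg _ _ (by norm_num), ← mul_assoc, ← sq, ← mul_pow, hsqrt]
  have holder := ENNReal.lintegral_mul_norm_pow_le hf (hf.mul (hg.pow_const 2))
    (p := 1 / 2) (q := 1 / 2) (by norm_num) (by norm_num) (by norm_num)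
  simp only [Pi.mul_apply, hprod] at holder
  calc (∫⁻ a, f a * g a ∂μ) ^ 2
      ≤ ((∫⁻ a, f a ∂μ) ^ (1 / 2 : ℝ) * (∫⁻ a, f a * g a ^ 2 ∂μ) ^ (1 / 2 : ℝ)) ^ 2 := by gcongr
    _ = (∫⁻ a, f a ∂μ) * ∫⁻ a, f a * g a ^ 2 ∂μ := by rw [mul_pow, hhalf, hhalf]

theorem eLpNorm_two_sq {E : Type*} [NormedAddCommGroup E] (f : X → E) :
    eLpNorm f 2 μ ^ 2 = ∫⁻ a, ‖f a‖ₑ ^ 2 ∂μ := by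
  simpa using eLpNorm_nnreal_pow_eq_lintegral (μ := μ) (f := f) (p := 2) two_ne_zero

/-- A kernel `k` on `X × X` satisfies the hypotheses of Schur's test on `L²(μ)` with constant `M`:
all the sections of `|k|` have integral at most `M`. -/
structure IsSchurKernel (k : X → X → ℝ) (μ : Measure X) (M : ℝ≥0) : Prop where
  measurable : Measurable (Function.uncurry k)
  lintegral_left_le : ∀ c, ∫⁻ a, ‖k a c‖ₑ ∂μ ≤ M
  lintegral_right_le : ∀ a, ∫⁻ c, ‖k a c‖ₑ ∂μ ≤ M

namespace IsSchurKernel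

variable {k k' : X → X → ℝ} {M M' : ℝ≥0}

theorem measurable_left (h : IsSchurKernel k μ M) (c : X) : Measurable fun a => k a c :=
  h.measurable.of_uncurry_right

theorem measurable_right (h : IsSchurKernel k μ M) (a : X) : Measurable fun c => k a c :=
  h.measurable.of_uncurry_left

theorem integrable_left (h : IsSchurKernel k μ M) (c : X) : Integrable (fun a => k a c) μ :=
  ⟨(h.measurable_left c).aestronglyMeasurable, (h.lintegral_left_le c).trans_lt ENNReal.coe_lt_top⟩

theorem measurable_mul (h : IsSchurKernel k μ M) (u : Lp ℝ 2 μ) :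
    Measurable fun p : X × X => k p.1 p.2 * u p.2 :=
  h.measurable.mul ((Lp.stronglyMeasurable u).measurable.comp measurable_snd)

variable [SFinite μ]

theorem lintegral_sq_lintegral_le (h : IsSchurKernel k μ M) {f : X → ℝ≥0∞} (hf : Measurable f) :
    ∫⁻ a, (∫⁻ c, ‖k a c‖ₑ * f c ∂μ) ^ 2 ∂μ ≤ M ^ 2 * ∫⁻ c, f c ^ 2 ∂μ := by
  have hm : Measurable (Function.uncurry fun a c => ‖k a c‖ₑ * f c ^ 2) :=
    h.measurable.enorm.mul ((hf.comp measurable_snd).pow_const 2)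
  have hm' : Measurable fun a => ∫⁻ c, ‖k a c‖ₑ * f c ^ 2 ∂μ := hm.lintegral_prod_right'
  calc ∫⁻ a, (∫⁻ c, ‖k a c‖ₑ * f c ∂μ) ^ 2 ∂μ
      ≤ ∫⁻ a, M * ∫⁻ c, ‖k a c‖ₑ * f c ^ 2 ∂μ ∂μ := by
        gcongr with a
        refine (lintegral_mul_sq_le (h.measurable_right a).enorm.aemeasurable
          hf.aemeasurable).trans ?_
        gcongr
        exact h.lintegral_right_le a
    _ = M * ∫⁻ c, ∫⁻ a, ‖k a c‖ₑ * f c ^ 2 ∂μ ∂μ := by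
        rw [lintegral_const_mul _ hm', lintegral_lintegral_swap hm.aemeasurable]
    _ = M * ∫⁻ c, (∫⁻ a, ‖k a c‖ₑ ∂μ) * f c ^ 2 ∂μ := by
        congr 1
        exact lintegral_congr fun c => lintegral_mul_const _ (h.measurable_left c).enorm
    _ ≤ M * ∫⁻ c, M * f c ^ 2 ∂μ := by
        gcongr with c
        exact h.lintegral_left_le c
    _ = M ^ 2 * ∫⁻ c, f c ^ 2 ∂μ := by
        rw [lintegral_const_mul _ (hf.pow_const 2), sq, mul_assoc]

theorem lintegral_sq_enorm_le (h : IsSchurKernel k μ M) (u : Lp ℝ 2 μ) :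
    ∫⁻ a, (∫⁻ c, ‖k a c * u c‖ₑ ∂μ) ^ 2 ∂μ ≤ (M * eLpNorm u 2 μ) ^ 2 := by
  simp only [enorm_mul]
  rw [mul_pow, eLpNorm_two_sq]
  exact h.lintegral_sq_lintegral_le (Lp.stronglyMeasurable u).measurable.enorm

theorem ae_integrable (h : IsSchurKernel k μ M) (u : Lp ℝ 2 μ) :
    ∀ᵐ a ∂μ, Integrable (fun c => k a c * u c) μ := by
  have hfinite : ∫⁻ a, (∫⁻ c, ‖k a c * u c‖ₑ ∂μ) ^ 2 ∂μ ≠ ⊤ :=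
    ne_top_of_le_ne_top (ENNReal.pow_ne_top
      (ENNReal.mul_ne_top ENNReal.coe_ne_top (Lp.eLpNorm_ne_top u))) (h.lintegral_sq_enorm_le u)
  have hm : Measurable fun a => (∫⁻ c, ‖k a c * u c‖ₑ ∂μ) ^ 2 :=
    (h.measurable_mul u).enorm.lintegral_prod_right'.pow_const 2
  filter_upwards [ae_lt_top hm hfinite] with a ha
  exact ⟨((h.measurable_mul u).comp measurable_prodMk_left).aestronglyMeasurable,
    (ENNReal.pow_lt_top_iff.1 ha).resolve_right two_ne_zero⟩

theorem eLpNorm_integral_le (h : IsSchurKernel k μ M) (u : Lp ℝ 2 μ) :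
    eLpNorm (fun a => ∫ c, k a c * u c ∂μ) 2 μ ≤ M * eLpNorm u 2 μ := by
  refine (ENNReal.pow_le_pow_left_iff two_ne_zero).1 ?_
  rw [eLpNorm_two_sq]
  refine le_trans (lintegral_mono fun a => ?_) (h.lintegral_sq_enorm_le u)
  gcongr
  exact enorm_integral_le_lintegral_enorm _

theorem memLp_integral (h : IsSchurKernel k μ M) (u : Lp ℝ 2 μ) :
    MemLp (fun a => ∫ c, k a c * u c ∂μ) 2 μ :=
  ⟨(h.measurable_mul u).stronglyMeasurable.integral_prod_right'.aestronglyMeasurable,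
    (h.eLpNorm_integral_le u).trans_lt (ENNReal.mul_lt_top ENNReal.coe_lt_top
      (Lp.eLpNorm_lt_top u))⟩

theorem norm_toLp_integral_le (h : IsSchurKernel k μ M) (u : Lp ℝ 2 μ) :
    ‖(h.memLp_integral u).toLp _‖ ≤ M * ‖u‖ := by
  rw [Lp.norm_toLp, Lp.norm_def, ← ENNReal.coe_toReal M, ← ENNReal.toReal_mul]
  exact ENNReal.toReal_mono (ENNReal.mul_ne_top ENNReal.coe_ne_top (Lp.eLpNorm_ne_top u))
    (h.eLpNorm_integral_le u)

/-- The integral operator `u ↦ ∫ k(·, c) u(c) dμ(c)` on `L²(μ)` attached to a Schur kernel. -/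
noncomputable def operator (h : IsSchurKernel k μ M) : Lp ℝ 2 μ →L[ℝ] Lp ℝ 2 μ :=
  LinearMap.mkContinuous
    { toFun := fun u => (h.memLp_integral u).toLp _
      map_add' := fun u v => by
        rw [← MemLp.toLp_add]
        refine MemLp.toLp_congr _ _ ?_
        filter_upwards [h.ae_integrable u, h.ae_integrable v] with a hu hv
        rw [Pi.add_apply, ← integral_add hu hv]
        refine integral_congr_ae ?_
        filter_upwards [Lp.coeFn_add u v] with c hc
        rw [hc, Pi.add_apply, mul_add]
      map_smul' := fun r u => by
        rw [RingHom.id_apply, ← MemLp.toLp_const_smul]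
        refine MemLp.toLp_congr _ _ (Eventually.of_forall fun a => ?_)
        rw [Pi.smul_apply, smul_eq_mul, ← integral_const_mul]
        refine integral_congr_ae ?_
        filter_upwards [Lp.coeFn_smul r u] with c hc
        rw [hc, Pi.smul_apply, smul_eq_mul, mul_left_comm] }
    M h.norm_toLp_integral_le

theorem coeFn_operator (h : IsSchurKernel k μ M) (u : Lp ℝ 2 μ) :
    h.operator u =ᵐ[μ] fun a => ∫ c, k a c * u c ∂μ :=
  (h.memLp_integral u).coeFn_toLp

theorem norm_operator_le (h : IsSchurKernel k μ M) : ‖h.operator‖ ≤ M :=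
  LinearMap.mkContinuous_norm_le _ M.coe_nonneg _

theorem operator_eq_sub {k'' : X → X → ℝ} {M'' : ℝ≥0} (h : IsSchurKernel k μ M)
    (h' : IsSchurKernel k' μ M') (h'' : IsSchurKernel k'' μ M'')
    (hk'' : ∀ a c, k'' a c = k a c - k' a c) : h''.operator = h.operator - h'.operator := by
  refine ContinuousLinearMap.ext fun u => Lp.ext ?_
  filter_upwards [h''.coeFn_operator u, h.coeFn_operator u, h'.coeFn_operator u,
    Lp.coeFn_sub (h.operator u) (h'.operator u), h.ae_integrable u, h'.ae_integrable u]
    with a hdiff hk hk' hsub hint hint'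
  rw [hdiff, sub_apply, hsub, Pi.sub_apply, hk, hk', ← integral_sub hint hint']
  simp only [hk'', sub_mul]

theorem integrable_prod (h : IsSchurKernel k μ M) {u : Lp ℝ 2 μ} (hu : Integrable u μ) :
    Integrable (fun p : X × X => k p.1 p.2 * u p.2) (μ.prod μ) := by
  have hm := h.measurable_mul u
  refine ⟨hm.aestronglyMeasurable, ?_⟩
  rw [hasFiniteIntegral_iff_enorm, lintegral_prod_symm' _ hm.enorm]
  calc ∫⁻ c, ∫⁻ a, ‖k a c * u c‖ₑ ∂μ ∂μ ≤ ∫⁻ c, M * ‖u c‖ₑ ∂μ := by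
        gcongr with c
        simp only [enorm_mul]
        rw [lintegral_mul_const _ (h.measurable_left c).enorm]
        gcongr
        exact h.lintegral_left_le c
    _ = M * ∫⁻ c, ‖u c‖ₑ ∂μ := lintegral_const_mul _ (Lp.stronglyMeasurable u).enorm
    _ < ⊤ := ENNReal.mul_lt_top ENNReal.coe_lt_top hu.hasFiniteIntegral

theorem integral_operator_mul (h : IsSchurKernel k μ M) {u : Lp ℝ 2 μ} (hu : Integrable u μ)
    {φ : X → ℝ} (hφ : AEStronglyMeasurable φ μ) {B : ℝ} (hB : ∀ a, ‖φ a‖ ≤ B) :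
    ∫ a, h.operator u a * φ a ∂μ = ∫ c, (∫ a, k a c * φ a ∂μ) * u c ∂μ := by
  have hint : Integrable (fun p : X × X => k p.1 p.2 * u p.2 * φ p.1) (μ.prod μ) :=
    (h.integrable_prod hu).mul_bdd hφ.comp_fst (Eventually.of_forall fun p => hB p.1)
  calc ∫ a, h.operator u a * φ a ∂μ = ∫ a, ∫ c, k a c * u c * φ a ∂μ ∂μ := by
        refine integral_congr_ae ?_
        filter_upwards [h.coeFn_operator u] with a ha
        rw [ha, integral_mul_const]
    _ = ∫ c, ∫ a, k a c * u c * φ a ∂μ ∂μ :=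
        integral_integral_swap (f := fun a c => k a c * u c * φ a) hint
    _ = ∫ c, (∫ a, k a c * φ a ∂μ) * u c ∂μ := by
        simp only [mul_right_comm _ (u _), integral_mul_const]

end IsSchurKernel

end Schur

/-! ### Compact integral operators -/

section Compact

variable {X : Type*} [TopologicalSpace X] [CompactSpace X]

section Inner

variable {H : Type*} [NormedAddCommGroup H] [InnerProductSpace ℝ H]

/-- The operator `u ↦ ⟪κ(·), u⟫` into the continuous functions given by a continuous family `κ` of
vectors: the abstract form of an integral operator with a continuous kernel. -/
noncomputable def innerOperator (κ : C(X, H)) : H →L[ℝ] BoundedContinuousFunction X ℝ :=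
  LinearMap.mkContinuous
    { toFun := fun u => BoundedContinuousFunction.mkOfCompact
        ⟨fun a => inner ℝ (κ a) u, κ.continuous.inner continuous_const⟩
      map_add' := fun u v => BoundedContinuousFunction.ext fun a => inner_add_right _ _ _
      map_smul' := fun r u => BoundedContinuousFunction.ext fun a => real_inner_smul_right _ _ _ }
    ‖κ‖ fun u => (BoundedContinuousFunction.norm_le (by positivity)).2 fun a =>
      (norm_inner_le_norm _ _).trans (by gcongr; exact κ.norm_coe_le_norm a)

theorem innerOperator_apply (κ : C(X, H)) (u : H) (a : X) :
    innerOperator κ u a = inner ℝ (κ a) u :=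
  rfl

theorem isCompactOperator_innerOperator (κ : C(X, H)) : IsCompactOperator (innerOperator κ) := by
  refine (isCompactOperator_iff_isCompact_closure_image_closedBall
    (innerOperator κ : H →ₗ[ℝ] BoundedContinuousFunction X ℝ) one_pos).2 ?_
  refine BoundedContinuousFunction.arzela_ascoli (Metric.closedBall 0 ‖innerOperator κ‖)
    (isCompact_closedBall _ _) _ ?_ fun a => ?_
  · rintro _ a ⟨u, hu, rfl⟩
    rw [mem_closedBall_zero_iff] at hu ⊢
    exact ((innerOperator κ u).norm_coe_le_norm a).trans ((innerOperator κ).unit_le_opNorm u hu)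
  · refine Metric.equicontinuousAt_of_continuity_modulus (fun b => ‖κ a - κ b‖) ?_ _ ?_
    · have hcont : Continuous fun b => ‖κ a - κ b‖ := by fun_prop
      simpa only [sub_self, norm_zero] using hcont.tendsto a
    · refine Eventually.of_forall fun b => ?_
      rintro ⟨_, u, hu, rfl⟩
      rw [mem_closedBall_zero_iff] at hu
      calc dist (inner ℝ (κ a) u) (inner ℝ (κ b) u) = ‖inner ℝ (κ a - κ b) u‖ := by
            rw [dist_eq_norm, inner_sub_left]
        _ ≤ ‖κ a - κ b‖ * ‖u‖ := norm_inner_le_norm _ _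
        _ ≤ ‖κ a - κ b‖ := mul_le_of_le_one_right (norm_nonneg _) hu

end Inner

theorem IsSchurKernel.isCompactOperator_of_continuous [SecondCountableTopologyEither X ℝ]
    [MeasurableSpace X] [BorelSpace X] {μ : Measure X} [IsFiniteMeasure μ] {k : X → X → ℝ}
    {M : ℝ≥0} (h : IsSchurKernel k μ M) (hk : Continuous (Function.uncurry k)) :
    IsCompactOperator h.operator := by
  let K : C(X, C(X, ℝ)) := ContinuousMap.curry ⟨Function.uncurry k, hk⟩
  let κ : C(X, Lp ℝ 2 μ) :=
    ⟨fun a => ContinuousMap.toLp 2 μ ℝ (K a), by fun_prop⟩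
  have hoperator (u : Lp ℝ 2 μ) :
      h.operator u = BoundedContinuousFunction.toLp 2 μ ℝ (innerOperator κ u) := by
    refine Lp.ext ?_
    filter_upwards [h.coeFn_operator u,
      BoundedContinuousFunction.coeFn_toLp 2 μ ℝ (innerOperator κ u)] with a ha ha'
    rw [ha, ha', innerOperator_apply, L2.inner_def]
    refine integral_congr_ae ?_
    filter_upwards [ContinuousMap.coeFn_toLp (𝕜 := ℝ) (p := 2) μ (K a)] with c hc
    rw [ContinuousMap.coe_mk, hc, real_inner_comm]
    rfl
  rw [show (h.operator : Lp ℝ 2 μ → Lp ℝ 2 μ) = _ from funext hoperator]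
  exact (isCompactOperator_innerOperator κ).clm_comp (BoundedContinuousFunction.toLp 2 μ ℝ)

end Compact

section Group

variable {G : Type*} [NormedAddCommGroup G]

/-- A continuous cutoff, vanishing for `‖t‖ ≤ 1 / (n + 1)` and equal to one for
`‖t‖ ≥ 2 / (n + 1)`. -/
noncomputable def cutoff (n : ℕ) (t : G) : ℝ :=
  max 0 (min 1 ((n + 1) * ‖t‖ - 1))

theorem continuous_cutoff (n : ℕ) : Continuous (cutoff n : G → ℝ) := by
  unfold cutoff
  fun_prop

theorem cutoff_nonneg (n : ℕ) (t : G) : 0 ≤ cutoff n t := le_max_left _ _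

theorem cutoff_le_one (n : ℕ) (t : G) : cutoff n t ≤ 1 :=
  max_le zero_le_one (min_le_left _ _)

theorem abs_cutoff_le_one (n : ℕ) (t : G) : |cutoff n t| ≤ 1 := by
  rw [abs_of_nonneg (cutoff_nonneg n t)]
  exact cutoff_le_one n t

theorem abs_one_sub_cutoff_le_one (n : ℕ) (t : G) : |1 - cutoff n t| ≤ 1 := by
  rw [abs_of_nonneg (sub_nonneg.2 (cutoff_le_one n t))]
  exact sub_le_self 1 (cutoff_nonneg n t)

theorem cutoff_eventuallyEq_zero (n : ℕ) : (cutoff n : G → ℝ) =ᶠ[𝓝 0] 0 := by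
  have hsmall : ∀ᶠ t : G in 𝓝 0, (n + 1 : ℝ) * ‖t‖ < 1 :=
    (by fun_prop : Continuous fun t : G => (n + 1 : ℝ) * ‖t‖).continuousAt.eventually_lt
      continuousAt_const (by simp)
  filter_upwards [hsmall] with t ht
  exact max_eq_left ((min_le_right _ _).trans (by linarith))

theorem tendsto_cutoff {t : G} (ht : t ≠ 0) : Tendsto (fun n => cutoff n t) atTop (𝓝 1) := by
  have hlarge : Tendsto (fun n : ℕ => ((n : ℝ) + 1) * ‖t‖) atTop atTop :=
    (tendsto_natCast_atTop_atTop.atTop_add tendsto_const_nhds).atTop_mul_const (norm_pos_iff.2 ht)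
  refine tendsto_const_nhds.congr' ?_
  filter_upwards [hlarge.eventually_ge_atTop 2] with n hn
  rw [cutoff, min_eq_left (by linarith), max_eq_right zero_le_one]

theorem continuous_mul_cutoff_sub {k : G → G → ℝ}
    (hk : ∀ p : G × G, p.1 ≠ p.2 → ContinuousAt (Function.uncurry k) p) (n : ℕ) :
    Continuous (Function.uncurry fun a c => k a c * cutoff n (a - c)) := by
  refine continuous_iff_continuousAt.2 fun p => ?_
  have hsub : Continuous fun q : G × G => q.1 - q.2 := continuous_fst.sub continuous_snd
  by_cases hp : p.1 = p.2
  · have htendsto : Tendsto (fun q : G × G => q.1 - q.2) (𝓝 p) (𝓝 0) := by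
      simpa only [hp, sub_self] using hsub.tendsto p
    refine (continuousAt_const (y := 0)).congr ?_
    filter_upwards [htendsto.eventually (cutoff_eventuallyEq_zero n)] with q hq
    simp only [Function.uncurry, hq, Pi.zero_apply, mul_zero]
  · exact (hk p hp).mul ((continuous_cutoff n).comp hsub).continuousAt

variable [MeasurableSpace G]

theorem tendsto_integral_mul_one_sub_cutoff [BorelSpace G] {w : G → ℝ} {μ : Measure G}
    (hw : Integrable w μ) (h0 : μ {0} = 0) :
    Tendsto (fun n => ∫ t, w t * |1 - cutoff n t| ∂μ) atTop (𝓝 0) := by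
  rw [← integral_zero G ℝ (μ := μ)]
  refine tendsto_integral_of_dominated_convergence (fun t => ‖w t‖) (fun n => ?_) hw.norm
    (fun n => Eventually.of_forall fun t => ?_) ?_
  · exact hw.aestronglyMeasurable.mul
      (continuous_const.sub (continuous_cutoff n)).abs.aestronglyMeasurable
  · rw [norm_mul, norm_abs_eq_norm]
    exact mul_le_of_le_one_right (norm_nonneg _) (abs_one_sub_cutoff_le_one n t)
  · filter_upwards [compl_mem_ae_iff.2 (h0)] with t ht
    simpa using ((tendsto_cutoff ht).const_sub 1).abs.const_mul (w t)

/-- A kernel on a group dominated by an integrable function `w` of the difference. Being a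
convolution kernel, the dominating kernel is a Schur kernel with constant `∫ w`. -/
structure IsDominatedKernel (k : G → G → ℝ) (w : G → ℝ) (μ : Measure G) : Prop where
  measurable : Measurable (Function.uncurry k)
  abs_le : ∀ a c, |k a c| ≤ w (a - c)
  integrable : Integrable w μ

namespace IsDominatedKernel

variable {k : G → G → ℝ} {w : G → ℝ} {μ : Measure G}

theorem weight_nonneg (h : IsDominatedKernel k w μ) (t : G) : 0 ≤ w t := by
  simpa only [sub_zero] using (abs_nonneg _).trans (h.abs_le t 0)

theorem isSchurKernel [MeasurableAdd G] [MeasurableNeg G] [μ.IsAddLeftInvariant] [μ.IsNegInvariant]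
    (h : IsDominatedKernel k w μ) : IsSchurKernel k μ (∫ t, w t ∂μ).toNNReal := by
  have hle (a c : G) : ‖k a c‖ₑ ≤ ‖w (a - c)‖ₑ := by
    rw [Real.enorm_eq_ofReal_abs, Real.enorm_eq_ofReal (h.weight_nonneg _)]
    exact ENNReal.ofReal_le_ofReal (h.abs_le a c)
  have hw : ∫⁻ t, ‖w t‖ₑ ∂μ = (∫ t, w t ∂μ).toNNReal := by
    rw [← ofReal_integral_norm_eq_lintegral_enorm h.integrable]
    simp only [Real.norm_of_nonneg (h.weight_nonneg _), ENNReal.ofReal]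
  refine ⟨h.measurable, fun c => (lintegral_mono fun a => hle a c).trans_eq ?_,
    fun a => (lintegral_mono fun c => hle a c).trans_eq ?_⟩
  · rw [lintegral_sub_right_eq_self (fun t => ‖w t‖ₑ) c, hw]
  · rw [lintegral_sub_left_eq_self (fun t => ‖w t‖ₑ) a, hw]

theorem norm_operator_le [MeasurableAdd G] [MeasurableNeg G] [SFinite μ] [μ.IsAddLeftInvariant]
    [μ.IsNegInvariant] (h : IsDominatedKernel k w μ) :
    ‖h.isSchurKernel.operator‖ ≤ ∫ t, w t ∂μ :=
  h.isSchurKernel.norm_operator_le.trans_eq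
    (Real.coe_toNNReal _ (integral_nonneg h.weight_nonneg))

theorem mul [MeasurableSub₂ G] (h : IsDominatedKernel k w μ) {χ : G → ℝ} (hχ : Measurable χ)
    (hχ_le : ∀ t, |χ t| ≤ 1) :
    IsDominatedKernel (fun a c => k a c * χ (a - c)) (fun t => w t * |χ t|) μ := by
  refine ⟨h.measurable.mul (hχ.comp measurable_sub), fun a c => ?_, ?_⟩
  · rw [abs_mul]
    gcongr
    exact h.abs_le a c
  · refine h.integrable.mul_bdd (c := 1) hχ.abs.aestronglyMeasurable
      (Eventually.of_forall fun t => ?_)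
    rw [norm_abs_eq_norm]
    exact hχ_le t

variable [BorelSpace G] [CompactSpace G] [IsFiniteMeasure μ] [μ.IsAddLeftInvariant]
  [μ.IsNegInvariant]

theorem isCompactOperator (h : IsDominatedKernel k w μ) (h0 : μ {0} = 0)
    (hk : ∀ p : G × G, p.1 ≠ p.2 → ContinuousAt (Function.uncurry k) p) :
    IsCompactOperator h.isSchurKernel.operator := by
  have hcut (n : ℕ) := h.mul (continuous_cutoff n).measurable (abs_cutoff_le_one n)
  have hrem (n : ℕ) := h.mul (χ := fun t => 1 - cutoff n t)
    (continuous_const.sub (continuous_cutoff n)).measurable (abs_one_sub_cutoff_le_one n)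
  have hdiff (n : ℕ) : ‖(hcut n).isSchurKernel.operator - h.isSchurKernel.operator‖ ≤
      ∫ t, w t * |1 - cutoff n t| ∂μ := by
    rw [norm_sub_rev, ← h.isSchurKernel.operator_eq_sub (hcut n).isSchurKernel
      (hrem n).isSchurKernel fun a c => mul_one_sub _ _]
    exact (hrem n).norm_operator_le
  refine isCompactOperator_of_tendsto
    (tendsto_iff_norm_sub_tendsto_zero.2 (squeeze_zero (fun _ => norm_nonneg _) hdiff
      (tendsto_integral_mul_one_sub_cutoff h.integrable h0)))
    (Eventually.of_forall fun n => (hcut n).isSchurKernel.isCompactOperator_of_continuous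
      (continuous_mul_cutoff_sub hk n))

end IsDominatedKernel

end Group

/-! ### Operators into products and into `H¹` -/

section ToLpProd

variable {E F F' : Type*} [NormedAddCommGroup E] [NormedSpace ℝ E] [NormedAddCommGroup F]
  [NormedSpace ℝ F] [NormedAddCommGroup F'] [NormedSpace ℝ F']

/-- The operator `u ↦ (A u, B u)` into the `ℓᵖ` product. -/
noncomputable def toLpProd (p : ℝ≥0∞) [Fact (1 ≤ p)] (A : E →L[ℝ] F) (B : E →L[ℝ] F') :
    E →L[ℝ] WithLp p (F × F') :=
  (WithLp.prodContinuousLinearEquiv p ℝ F F').symm ∘L A.prod B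

variable {p : ℝ≥0∞} [Fact (1 ≤ p)]

theorem toLpProd_eq_add (A : E →L[ℝ] F) (B : E →L[ℝ] F') (u : E) :
    toLpProd p A B u = WithLp.toLp p (A u, 0) + WithLp.toLp p (0, B u) := by
  rw [← WithLp.toLp_add, Prod.mk_add_mk, add_zero, zero_add]
  rfl

theorem isCompactOperator_toLpProd {A : E →L[ℝ] F} {B : E →L[ℝ] F'} (hA : IsCompactOperator A)
    (hB : IsCompactOperator B) : IsCompactOperator (toLpProd p A B) := by
  let e : F × F' →L[ℝ] WithLp p (F × F') := (WithLp.prodContinuousLinearEquiv p ℝ F F').symm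
  have hadd := (hA.clm_comp (e ∘L ContinuousLinearMap.inl ℝ F F')).add
    (hB.clm_comp (e ∘L ContinuousLinearMap.inr ℝ F F'))
  rwa [show ⇑(toLpProd p A B) = _ from funext (toLpProd_eq_add A B)]

theorem norm_toLpProd_le (A : E →L[ℝ] F) (B : E →L[ℝ] F') :
    ‖toLpProd p A B‖ ≤ ‖A‖ + ‖B‖ := by
  refine ContinuousLinearMap.opNorm_le_bound _ (by positivity) fun u => ?_
  calc ‖toLpProd p A B u‖ ≤ ‖WithLp.toLp p (A u, (0 : F'))‖ + ‖WithLp.toLp p ((0 : F), B u)‖ := by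
        rw [toLpProd_eq_add]
        exact norm_add_le _ _
    _ = ‖A u‖ + ‖B u‖ := by rw [WithLp.norm_toLp_fst, WithLp.norm_toLp_snd]
    _ ≤ (‖A‖ + ‖B‖) * ‖u‖ := by
        rw [add_mul]
        exact add_le_add (A.le_opNorm u) (B.le_opNorm u)

/-- The operator on `ℓ¹` pairs with operator matrix `(A, B; C, D)`. -/
noncomputable def matrixOperator (A B C D : E →L[ℝ] F) :
    WithLp 1 (E × E) →L[ℝ] WithLp 1 (F × F) :=
  toLpProd 1 (A ∘L WithLp.fstL 1 ℝ E E + B ∘L WithLp.sndL 1 ℝ E E)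
    (C ∘L WithLp.fstL 1 ℝ E E + D ∘L WithLp.sndL 1 ℝ E E)

theorem isCompactOperator_matrixOperator {A B C D : E →L[ℝ] F} (hA : IsCompactOperator A)
    (hB : IsCompactOperator B) (hC : IsCompactOperator C) (hD : IsCompactOperator D) :
    IsCompactOperator (matrixOperator A B C D) :=
  isCompactOperator_toLpProd ((hA.comp_clm _).add (hB.comp_clm _))
    ((hC.comp_clm _).add (hD.comp_clm _))

theorem norm_matrixOperator_le (A B C D : E →L[ℝ] F) :
    ‖matrixOperator A B C D‖ ≤ ‖A‖ + ‖B‖ + ‖C‖ + ‖D‖ := by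
  have hfst : ‖WithLp.fstL 1 ℝ E E‖ ≤ 1 :=
    ContinuousLinearMap.opNorm_le_bound _ zero_le_one fun w => by
      rw [one_mul]; exact WithLp.norm_fst_le _ w
  have hsnd : ‖WithLp.sndL 1 ℝ E E‖ ≤ 1 :=
    ContinuousLinearMap.opNorm_le_bound _ zero_le_one fun w => by
      rw [one_mul]; exact WithLp.norm_snd_le _ w
  have hrow (A B : E →L[ℝ] F) :
      ‖A ∘L WithLp.fstL 1 ℝ E E + B ∘L WithLp.sndL 1 ℝ E E‖ ≤ ‖A‖ + ‖B‖ :=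
    (norm_add_le _ _).trans <| add_le_add
      ((A.opNorm_comp_le _).trans (mul_le_of_le_one_right (norm_nonneg A) hfst))
      ((B.opNorm_comp_le _).trans (mul_le_of_le_one_right (norm_nonneg B) hsnd))
  refine (norm_toLpProd_le _ _).trans ?_
  linarith [hrow A B, hrow C D]

end ToLpProd

theorem continuous_integral_mul (φ : C(AddCircle (2 * π), ℝ)) :
    Continuous fun u : L2 => ∫ x, u x * φ x := by
  have hinner (u : L2) : ∫ x, u x * φ x = inner ℝ (ContinuousMap.toLp 2 volume ℝ φ : L2) u := by
    rw [L2.inner_def]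
    refine integral_congr_ae ?_
    filter_upwards [ContinuousMap.coeFn_toLp (p := 2) (𝕜 := ℝ) volume φ] with x hx
    rw [hx]
    rfl
  simp only [hinner]
  exact continuous_const.inner continuous_id

theorem isClosed_H1 : IsClosed (H1 : Set (WithLp 2 (L2 × L2))) := by
  simp only [H1, IsWeakDeriv, Submodule.coe_set_mk, AddSubmonoid.coe_set_mk,
    AddSubsemigroup.coe_set_mk, Set.ofPred_forall]
  refine isClosed_iInter fun φ => isClosed_iInter fun ψ => isClosed_iInter fun _ =>
    isClosed_iInter fun _ => isClosed_eq ?_ ?_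
  · exact (continuous_integral_mul ψ).comp (WithLp.continuous_fst 2 _ _)
  · exact ((continuous_integral_mul φ).comp (WithLp.continuous_snd 2 _ _)).neg

section Lift

variable {E : Type*} [NormedAddCommGroup E] [NormedSpace ℝ E] {A B : E →L[ℝ] L2}

/-- The operator into `H¹` given by an operator `A` into `L²` and the operator `B` of weak
derivatives of its values. -/
noncomputable def H1.lift (A B : E →L[ℝ] L2) (hAB : ∀ u, IsWeakDeriv (A u) (B u)) : E →L[ℝ] H1 :=
  (toLpProd 2 A B).codRestrict H1 hAB

theorem H1.isCompactOperator_lift (hAB : ∀ u, IsWeakDeriv (A u) (B u)) (hA : IsCompactOperator A)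
    (hB : IsCompactOperator B) : IsCompactOperator (H1.lift A B hAB) :=
  (isCompactOperator_toLpProd hA hB).codRestrict hAB isClosed_H1

theorem H1.norm_lift_le (hAB : ∀ u, IsWeakDeriv (A u) (B u)) :
    ‖H1.lift A B hAB‖ ≤ ‖A‖ + ‖B‖ :=
  (ContinuousLinearMap.opNorm_le_bound _ (norm_nonneg _) (toLpProd 2 A B).le_opNorm).trans
    (norm_toLpProd_le A B)

end Lift

/-! ### Differentiation of kernels on the circle -/

section KernelDeriv

variable {T : ℝ} [hT : Fact (0 < T)]

/-- The kernel `l` is the derivative of `k` in the first variable off the diagonal, and `k` has no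
jump on the diagonal. The second condition excludes a Dirac mass in the weak derivative. -/
structure IsKernelDeriv (k l : AddCircle T → AddCircle T → ℝ) : Prop where
  hasDerivAt : ∀ (c : AddCircle T) (t : ℝ), (t : AddCircle T) ≠ c →
    HasDerivAt (fun s : ℝ => k s c) (l t c) t
  exists_tendsto : ∀ c, ∃ y, Tendsto (fun a => k a c) (𝓝[≠] c) (𝓝 y)

theorem tendsto_coe_addCircle_nhdsNE (t : ℝ) :
    Tendsto (fun s : ℝ => (s : AddCircle T)) (𝓝[≠] t) (𝓝[≠] (t : AddCircle T)) := by
  have hTpos : 0 < T := hT.out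
  refine tendsto_nhdsWithin_iff.2
    ⟨((AddCircle.continuous_mk' _).tendsto t).mono_left nhdsWithin_le_nhds, ?_⟩
  have hball : ∀ᶠ s in 𝓝[≠] t, s ∈ Metric.ball t (T / 2) :=
    nhdsWithin_le_nhds (Metric.ball_mem_nhds _ (half_pos hTpos))
  filter_upwards [hball, self_mem_nhdsWithin] with s hs hne heq
  rw [Metric.mem_ball, Real.dist_eq, abs_lt] at hs
  exact hne ((AddCircle.coe_eq_coe_iff_of_mem_Ico (a := t - T / 2)
    ⟨by linarith, by linarith⟩ ⟨by linarith, by linarith⟩).1 heq)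

theorem IsKernelDeriv.integral_mul_deriv_eq {k l : AddCircle T → AddCircle T → ℝ}
    (h : IsKernelDeriv k l) {c : AddCircle T} (hk : Integrable fun a => k a c)
    (hl : Integrable fun a => l a c) {φ ψ : C(AddCircle T, ℝ)}
    (hφ : ∀ t : ℝ, HasDerivAt (fun s : ℝ => φ s) (ψ t) t) :
    ∫ a, k a c * ψ a = - ∫ a, l a c * φ a := by
  obtain ⟨γ, rfl⟩ := QuotientAddGroup.mk_surjective c
  obtain ⟨y, hy⟩ := h.exists_tendsto γ
  have hint {f : AddCircle T → ℝ} (hf : Integrable f) (χ : C(AddCircle T, ℝ)) :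
      Integrable fun a => f a * χ a :=
    hf.mul_bdd (c := ‖χ‖) χ.continuous.aestronglyMeasurable
      (Eventually.of_forall χ.norm_coe_le_norm)
  have hlt : γ < γ + T := lt_add_of_pos_right γ hT.out
  have htendsto (t : ℝ) (ht : (t : AddCircle T) = γ) (s : Set ℝ) (hs : s ⊆ {t}ᶜ) :
      Tendsto (fun r : ℝ => k r γ * φ r) (𝓝[s] t) (𝓝 (y * φ γ)) := by
    have hmk := tendsto_coe_addCircle_nhdsNE (T := T) t
    have hφt : Tendsto (fun r : ℝ => φ r) (𝓝[s] t) (𝓝 (φ t)) :=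
      (φ.continuous.comp (AddCircle.continuous_mk' T)).continuousAt.continuousWithinAt
    rw [ht] at hmk hφt
    exact (hy.comp (hmk.mono_left (nhdsWithin_mono t hs))).mul hφt
  rw [eq_neg_iff_add_eq_zero, ← integral_add (hint hk ψ) (hint hl φ),
    ← AddCircle.intervalIntegral_preimage T γ,
    intervalIntegral.integral_eq_sub_of_hasDerivAt_of_tendsto
      (f := fun s : ℝ => k s γ * φ s) hlt ?_ ?_
      (htendsto γ rfl _ fun s hs => ne_of_gt hs)
      (htendsto (γ + T) (AddCircle.coe_add_period T γ) _ fun s hs => ne_of_lt hs), sub_self]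
  · intro t ht
    have hne : (t : AddCircle T) ≠ γ := fun heq => ht.1.ne'
      ((AddCircle.coe_eq_coe_iff_of_mem_Ico (a := γ) ⟨ht.1.le, ht.2⟩ ⟨le_rfl, hlt⟩).1 heq)
    exact ((h.hasDerivAt γ t hne).mul (hφ t)).congr_deriv (add_comm _ _)
  · rw [intervalIntegrable_iff_integrableOn_Ioc_of_le hlt.le]
    exact (AddCircle.measurePreserving_mk T γ).integrable_comp_of_integrable
      ((hint hk ψ).add (hint hl φ))

end KernelDeriv

theorem IsSchurKernel.isWeakDeriv {k l : AddCircle (2 * π) → AddCircle (2 * π) → ℝ} {M M' : ℝ≥0}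
    (hk : IsSchurKernel k volume M) (hl : IsSchurKernel l volume M') (hkl : IsKernelDeriv k l)
    (u : L2) : IsWeakDeriv (hk.operator u) (hl.operator u) := by
  intro φ ψ _ hφ
  have hu : Integrable u := (Lp.memLp u).integrable one_le_two
  rw [hk.integral_operator_mul hu ψ.continuous.aestronglyMeasurable ψ.norm_coe_le_norm,
    hl.integral_operator_mul hu φ.continuous.aestronglyMeasurable φ.norm_coe_le_norm,
    ← integral_neg]
  simp only [hkl.integral_mul_deriv_eq (hk.integrable_left _) (hl.integrable_left _) hφ, neg_mul]

theorem volume_addCircle_singleton (t : AddCircle (2 * π)) : volume {t} = 0 := by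
  have hball := AddCircle.volume_closedBall (T := 2 * π) (x := t) 0
  rwa [Metric.closedBall_zero, mul_zero, min_eq_right Real.two_pi_pos.le,
    ENNReal.ofReal_zero] at hball

namespace IsDominatedKernel

variable {k l : AddCircle (2 * π) → AddCircle (2 * π) → ℝ} {w w' : AddCircle (2 * π) → ℝ}

/-- The operator from `L²` to `H¹` given by a dominated kernel with dominated derivative. -/
noncomputable def H1Operator (hk : IsDominatedKernel k w volume)
    (hl : IsDominatedKernel l w' volume) (hkl : IsKernelDeriv k l) : L2 →L[ℝ] H1 :=
  H1.lift hk.isSchurKernel.operator hl.isSchurKernel.operator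
    (hk.isSchurKernel.isWeakDeriv hl.isSchurKernel hkl)

theorem toL2_H1Operator (hk : IsDominatedKernel k w volume) (hl : IsDominatedKernel l w' volume)
    (hkl : IsKernelDeriv k l) (u : L2) :
    H1.toL2 (hk.H1Operator hl hkl u) =ᵐ[volume] fun a => ∫ c, k a c * u c :=
  hk.isSchurKernel.coeFn_operator u

theorem norm_H1Operator_le (hk : IsDominatedKernel k w volume)
    (hl : IsDominatedKernel l w' volume) (hkl : IsKernelDeriv k l) :
    ‖hk.H1Operator hl hkl‖ ≤ (∫ t, w t) + ∫ t, w' t :=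
  (H1.norm_lift_le _).trans (add_le_add hk.norm_operator_le hl.norm_operator_le)

theorem isCompactOperator_H1Operator (hk : IsDominatedKernel k w volume)
    (hl : IsDominatedKernel l w' volume) (hkl : IsKernelDeriv k l)
    (hkc : ∀ p : AddCircle (2 * π) × AddCircle (2 * π), p.1 ≠ p.2 →
      ContinuousAt (Function.uncurry k) p)
    (hlc : ∀ p : AddCircle (2 * π) × AddCircle (2 * π), p.1 ≠ p.2 →
      ContinuousAt (Function.uncurry l) p) :
    IsCompactOperator (hk.H1Operator hl hkl) :=
  H1.isCompactOperator_lift _ (hk.isCompactOperator (volume_addCircle_singleton 0) hkc)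
    (hl.isCompactOperator (volume_addCircle_singleton 0) hlc)

end IsDominatedKernel

/-! ### Principal values and periodization -/

section PrincipalValue

variable {E : Type*} [NormedAddCommGroup E] [NormedSpace ℝ E] {f : ℝ → E}

theorem tendsto_intervalIntegral_neg_self (hf : ∀ a b, IntervalIntegrable f volume a b) :
    Tendsto (fun ε : ℝ => ∫ β in -ε..ε, f β) (𝓝[>] 0) (𝓝 0) := by
  have hprim : Continuous fun x : ℝ => ∫ β in (0 : ℝ)..x, f β :=
    intervalIntegral.continuous_primitive hf 0
  have hdiff : Tendsto (fun ε : ℝ => (∫ β in (0 : ℝ)..ε, f β) - ∫ β in (0 : ℝ)..(-ε), f β)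
      (𝓝 0) (𝓝 0) :=
    Continuous.tendsto' (by fun_prop) 0 0 (by simp)
  refine (hdiff.mono_left nhdsWithin_le_nhds).congr fun ε => ?_
  rw [intervalIntegral.integral_interval_sub_left (hf _ _) (hf _ _)]

theorem hasPV_of_tendsto (hf : ∀ a b, IntervalIntegrable f volume a b) {y : E}
    (hy : Tendsto (fun R : ℝ => ∫ β in -R..R, f β) atTop (𝓝 y)) : HasPV f y := by
  have hset (ε R : ℝ) : {β : ℝ | ε < |β| ∧ |β| < R} = Set.Ioo (-R) R \ Set.Icc (-ε) ε := by
    ext β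
    simp only [Set.mem_ofPred_eq, Set.mem_sdiff, Set.mem_Ioo, Set.mem_Icc, ← abs_lt, ← abs_le,
      not_le]
    exact and_comm
  have hIoo (R : ℝ) : IntegrableOn f (Set.Ioo (-R) R) :=
    (hf (-R) R).1.mono_set Set.Ioo_subset_Ioc_self
  refine ⟨fun ε R _ => ?_, ?_⟩
  · rw [hset]
    exact (hIoo R).mono_set Set.sdiff_subset
  have hlim : Tendsto (fun p : ℝ × ℝ => (∫ β in -p.2..p.2, f β) - ∫ β in -p.1..p.1, f β)
      (𝓝[>] 0 ×ˢ atTop) (𝓝 y) := by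
    have hsub := (hy.comp tendsto_snd).sub
      ((tendsto_intervalIntegral_neg_self hf).comp (tendsto_fst (g := (atTop : Filter ℝ))))
    rwa [sub_zero] at hsub
  refine hlim.congr' ?_
  filter_upwards [tendsto_fst.eventually (Ioo_mem_nhdsGT one_pos),
    tendsto_snd.eventually (eventually_gt_atTop 1)] with p ⟨hε0, hε1⟩ hR
  rw [hset, setIntegral_sdiff measurableSet_Icc (hIoo _)
      (Set.Icc_subset_Ioo (by linarith) (by linarith)), integral_Icc_eq_integral_Ioc,
    ← integral_Ioc_eq_integral_Ioo, ← intervalIntegral.integral_of_le (by linarith),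
    ← intervalIntegral.integral_of_le (by linarith)]

end PrincipalValue

section PeriodSum

variable {p : ℝ} {f v κ s : ℝ → ℝ}

/-- The sum of the translates `κ (β + 2pj)` over `|j| ≤ n`. -/
noncomputable def periodSum (p : ℝ) (κ : ℝ → ℝ) (n : ℕ) (β : ℝ) : ℝ :=
  κ β + ∑ j ∈ Finset.range n, (κ (β + 2 * p * (j + 1)) + κ (β - 2 * p * (j + 1)))

theorem periodSum_succ (p : ℝ) (κ : ℝ → ℝ) (n : ℕ) (β : ℝ) :
    periodSum p κ (n + 1) β =
      periodSum p κ n β + (κ (β + 2 * p * (n + 1)) + κ (β - 2 * p * (n + 1))) := by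
  rw [periodSum, Finset.sum_range_succ, ← add_assoc, periodSum]

theorem measurable_periodSum (hκ : Measurable κ) (n : ℕ) : Measurable (periodSum p κ n) := by
  unfold periodSum
  fun_prop

theorem periodSum_mul (hv : Function.Periodic v (2 * p)) (n : ℕ) (β : ℝ) :
    periodSum p (fun β => κ β * v β) n β = periodSum p κ n β * v β := by
  have hadd (j : ℕ) : v (β + 2 * p * (j + 1)) = v β := by
    rw [mul_comm]
    exact_mod_cast hv.nat_mul (j + 1) β
  have hsub (j : ℕ) : v (β - 2 * p * (j + 1)) = v β := by
    rw [mul_comm]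
    exact_mod_cast hv.sub_nat_mul_eq (j + 1)
  simp only [periodSum, hadd, hsub, ← add_mul, ← Finset.sum_mul]

theorem intervalIntegral_periodSum (hf : ∀ a b, IntervalIntegrable f volume a b) (n : ℕ) :
    ∫ β in -p..p, periodSum p f n β = ∫ β in -((2 * n + 1) * p)..((2 * n + 1) * p), f β := by
  have hadd (c : ℝ) : IntervalIntegrable (fun β => f (β + c)) volume (-p) p := by
    simpa using (hf (-p + c) (p + c)).comp_add_right c
  have hsub (c : ℝ) : IntervalIntegrable (fun β => f (β - c)) volume (-p) p := hadd (-c)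
  have hsum (n : ℕ) : IntervalIntegrable (periodSum p f n) volume (-p) p := by
    refine (hf _ _).add ?_
    rw [← Finset.sum_fn]
    exact IntervalIntegrable.sum _ fun j _ => (hadd _).add (hsub _)
  induction n with
  | zero => simp [periodSum]
  | succ n ih =>
    simp only [periodSum_succ]
    rw [intervalIntegral.integral_add (hsum n) ((hadd _).add (hsub _)),
      intervalIntegral.integral_add (hadd _) (hsub _), ih,
      intervalIntegral.integral_comp_add_right f, intervalIntegral.integral_comp_sub_right f,
      show -p + 2 * p * (n + 1) = (2 * n + 1) * p by ring,
      show p + 2 * p * (n + 1) = (2 * (n + 1 : ℕ) + 1) * p by push_cast; ring,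
      show -p - 2 * p * (n + 1) = -((2 * (n + 1 : ℕ) + 1) * p) by push_cast; ring,
      show p - 2 * p * (n + 1) = -((2 * n + 1) * p) by ring, ← add_assoc,
      intervalIntegral.integral_add_adjacent_intervals (hf _ _) (hf _ _), add_comm,
      intervalIntegral.integral_add_adjacent_intervals (hf _ _) (hf _ _)]

theorem abs_intervalIntegral_le_of_periodic {T a b c : ℝ} (hv : Function.Periodic v T)
    (hvi : ∀ a b, IntervalIntegrable v volume a b) (hc : 0 ≤ c) (hab : a ≤ b) (hb : b ≤ a + T)
    (hf : ∀ β ∈ Set.Ioc a b, |f β| ≤ c * |v β|) :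
    |∫ β in a..b, f β| ≤ c * ∫ β in (0 : ℝ)..T, |v β| := by
  have hperiod : ∫ β in a..a + T, |v β| = ∫ β in (0 : ℝ)..T, |v β| := by
    simpa using (hv.comp abs).intervalIntegral_add_eq a 0
  calc |∫ β in a..b, f β| ≤ ∫ β in a..b, c * |v β| := by
        rw [← Real.norm_eq_abs]
        exact intervalIntegral.norm_integral_le_of_norm_le hab (Eventually.of_forall hf)
          ((hvi _ _).abs.const_mul _)
    _ = c * ∫ β in a..b, |v β| := intervalIntegral.integral_const_mul _ _
    _ ≤ c * ∫ β in (0 : ℝ)..T, |v β| := by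
        rw [← hperiod]
        gcongr
        exact intervalIntegral.integral_mono_interval le_rfl hab hb
          (Eventually.of_forall fun β => abs_nonneg _) (hvi _ _).abs

theorem abs_symmetric_integral_sub_le {T C r R : ℝ} (hv : Function.Periodic v T)
    (hvi : ∀ a b, IntervalIntegrable v volume a b) (hf : ∀ a b, IntervalIntegrable f volume a b)
    (hC : 0 ≤ C) (hfC : ∀ β, |f β| * |β| ≤ C * |v β|) (hr : 0 < r) (hrR : r ≤ R)
    (hRr : R ≤ r + T) :
    |(∫ β in -R..R, f β) - ∫ β in -r..r, f β| ≤ 2 * (C / r * ∫ β in (0 : ℝ)..T, |v β|) := by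
  have hbound (β : ℝ) (hβ : r ≤ |β|) : |f β| ≤ C / r * |v β| := by
    rw [div_mul_eq_mul_div, le_div_iff₀ hr]
    exact (mul_le_mul_of_nonneg_left hβ (abs_nonneg _)).trans (hfC β)
  have hsplit : (∫ β in -R..R, f β) - ∫ β in -r..r, f β =
      (∫ β in -R..-r, f β) + ∫ β in r..R, f β := by
    rw [← intervalIntegral.integral_add_adjacent_intervals (hf (-R) (-r)) (hf _ R),
      ← intervalIntegral.integral_add_adjacent_intervals (hf (-r) r) (hf _ R)]
    ring
  rw [hsplit, two_mul]
  refine (abs_add_le _ _).trans (add_le_add ?_ ?_)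
  · exact abs_intervalIntegral_le_of_periodic hv hvi (by positivity) (by linarith) (by linarith)
      fun β hβ => hbound β (le_abs.2 (Or.inr (by linarith [hβ.2])))
  · exact abs_intervalIntegral_le_of_periodic hv hvi (by positivity) hrR hRr
      fun β hβ => hbound β (le_abs.2 (Or.inl hβ.1.le))

theorem le_odd_floor_mul {R : ℝ} (hp : 0 < p) (hR : p ≤ R) :
    (2 * ⌊(R / p - 1) / 2⌋₊ + 1) * p ≤ R ∧ R ≤ (2 * ⌊(R / p - 1) / 2⌋₊ + 1) * p + 2 * p := by
  have hnonneg : 0 ≤ (R / p - 1) / 2 := by linarith [(one_le_div hp).2 hR]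
  have hle : (2 * (⌊(R / p - 1) / 2⌋₊ : ℝ) + 1) ≤ R / p := by linarith [Nat.floor_le hnonneg]
  have hlt : R / p ≤ 2 * (⌊(R / p - 1) / 2⌋₊ : ℝ) + 3 := by
    linarith [Nat.lt_floor_add_one ((R / p - 1) / 2)]
  rw [le_div_iff₀ hp] at hle
  rw [div_le_iff₀ hp] at hlt
  exact ⟨hle, by linarith⟩

theorem tendsto_symmetric_integral_of_odd {C y : ℝ} (hp : 0 < p) (hv : Function.Periodic v (2 * p))
    (hvi : ∀ a b, IntervalIntegrable v volume a b) (hf : ∀ a b, IntervalIntegrable f volume a b)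
    (hC : 0 ≤ C) (hfC : ∀ β, |f β| * |β| ≤ C * |v β|)
    (hy : Tendsto (fun n : ℕ => ∫ β in -((2 * n + 1) * p)..((2 * n + 1) * p), f β) atTop (𝓝 y)) :
    Tendsto (fun R : ℝ => ∫ β in -R..R, f β) atTop (𝓝 y) := by
  have hfloor : Tendsto (fun R : ℝ => ⌊(R / p - 1) / 2⌋₊) atTop atTop :=
    tendsto_nat_floor_atTop.comp
      (((tendsto_id.atTop_div_const hp).atTop_add tendsto_const_nhds).atTop_div_const two_pos)
  have hodd : Tendsto (fun n : ℕ => (2 * (n : ℝ) + 1) * p) atTop atTop :=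
    ((tendsto_natCast_atTop_atTop.const_mul_atTop two_pos).atTop_add
      tendsto_const_nhds).atTop_mul_const hp
  have htail : Tendsto (fun n : ℕ => 2 * (C / ((2 * n + 1) * p) * ∫ β in (0 : ℝ)..2 * p, |v β|))
      atTop (𝓝 0) := by
    simpa using ((hodd.const_div_atTop C).mul_const _).const_mul 2
  have hdiff : Tendsto (fun R => (∫ β in -R..R, f β) -
      ∫ β in -((2 * ⌊(R / p - 1) / 2⌋₊ + 1) * p)..((2 * ⌊(R / p - 1) / 2⌋₊ + 1) * p), f β)
      atTop (𝓝 0) := by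
    refine squeeze_zero_norm' ?_ (htail.comp hfloor)
    filter_upwards [eventually_ge_atTop p] with R hR
    exact abs_symmetric_integral_sub_le hv hvi hf hC hfC (by positivity)
      (le_odd_floor_mul hp hR).1 (le_odd_floor_mul hp hR).2
  simpa using hdiff.add (hy.comp hfloor)

theorem hasPV_mul_of_tendsto_periodSum {B C M : ℝ} (hp : 0 < p)
    (hv : Function.Periodic v (2 * p)) (hvi : ∀ a b, IntervalIntegrable v volume a b)
    (hκ : Measurable κ) (hB : ∀ β, |κ β| ≤ B) (hC : ∀ β, |κ β| * |β| ≤ C)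
    (hM : ∀ n, ∀ β ∈ Set.Ioc (-p) p, |periodSum p κ n β| ≤ M)
    (hs : ∀ β ∈ Set.Ioc (-p) p, β ≠ 0 →
      Tendsto (fun n => periodSum p κ n β) atTop (𝓝 (s β))) :
    HasPV (fun β => κ β * v β) (∫ β in -p..p, s β * v β) := by
  have hf (a b : ℝ) : IntervalIntegrable (fun β => κ β * v β) volume a b := by
    rw [intervalIntegrable_iff]
    exact (intervalIntegrable_iff.1 (hvi a b)).bdd_mul hκ.aestronglyMeasurable
      (Eventually.of_forall hB)
  have hfC (β : ℝ) : |κ β * v β| * |β| ≤ C * |v β| := by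
    rw [abs_mul, mul_right_comm]
    exact mul_le_mul_of_nonneg_right (hC β) (abs_nonneg _)
  refine hasPV_of_tendsto hf (tendsto_symmetric_integral_of_odd hp hv hvi hf
    ((mul_nonneg (abs_nonneg _) (abs_nonneg _)).trans (hC 0)) hfC ?_)
  simp only [← intervalIntegral_periodSum hf, periodSum_mul hv]
  have hIoc : Set.uIoc (-p) p = Set.Ioc (-p) p := Set.uIoc_of_le (by linarith)
  refine intervalIntegral.tendsto_integral_filter_of_dominated_convergence
    (fun β => M * |v β|) (Eventually.of_forall fun n => ?_) (Eventually.of_forall fun n => ?_)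
    ((hvi _ _).abs.const_mul M) ?_
  · exact (measurable_periodSum hκ n).aestronglyMeasurable.mul
      (intervalIntegrable_iff.1 (hvi _ _)).aestronglyMeasurable
  · refine Eventually.of_forall fun β hβ => ?_
    rw [norm_mul, Real.norm_eq_abs, Real.norm_eq_abs]
    exact mul_le_mul_of_nonneg_right (hM n β (hIoc ▸ hβ)) (abs_nonneg _)
  · filter_upwards [Measure.ae_ne volume (0 : ℝ)] with β hβ0 hβ
    exact (hs β (hIoc ▸ hβ) hβ0).mul_const _

end PeriodSum

/-! ### The periodized Cauchy kernel -/

/-- `½ cot(w/2)`, the periodization of `1/w` over the translations by `2π`. -/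
noncomputable def halfCot (w : ℂ) : ℂ := Complex.cot (w / 2) / 2

theorem hasSum_halfCot {w : ℂ} (hw : ∀ m : ℤ, w + 2 * π * m ≠ 0) :
    HasSum (fun j : ℕ => 1 / (w + 2 * π * (j + 1)) + 1 / (w - 2 * π * (j + 1)))
      (halfCot w - 1 / w) := by
  have hπ : (π : ℂ) ≠ 0 := Complex.ofReal_ne_zero.2 Real.pi_ne_zero
  have hmem : w / (2 * π) ∈ Complex.integerComplement := by
    rw [Complex.mem_integerComplement_iff]
    rintro ⟨m, hm⟩
    refine hw (-m) ?_
    rw [eq_div_iff (by simp)] at hm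
    push_cast
    linear_combination -hm
  have hterm (j : ℕ) : 1 / (2 * π : ℂ) * cotTerm (w / (2 * π)) j =
      1 / (w + 2 * π * (j + 1)) + 1 / (w - 2 * π * (j + 1)) := by
    have hadd : w + 2 * π * (j + 1) ≠ 0 := by exact_mod_cast hw (j + 1)
    have hsub : w - 2 * π * (j + 1) ≠ 0 := by
      have h := hw (-(j + 1))
      push_cast at h
      rwa [mul_neg, ← sub_eq_add_neg] at h
    rw [cotTerm, show w / (2 * π) - (j + 1) = (w - 2 * π * (j + 1)) / (2 * π) by field_simp,
      show w / (2 * π) + (j + 1) = (w + 2 * π * (j + 1)) / (2 * π) by field_simp]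
    field_simp
    ring
  have hvalue : 1 / (2 * π : ℂ) * (π * Complex.cot (π * (w / (2 * π))) - 1 / (w / (2 * π))) =
      halfCot w - 1 / w := by
    have hw0 : w ≠ 0 := by simpa using hw 0
    rw [halfCot, show (π : ℂ) * (w / (2 * π)) = w / 2 by field_simp]
    field_simp
  have hsum := (summable_cotTerm hmem).hasSum.mul_left (1 / (2 * π : ℂ))
  have htsum : ∑' j, cotTerm (w / (2 * π)) j = _ := (cot_series_rep' hmem).symm
  rw [htsum, hvalue] at hsum
  simpa only [hterm] using hsum

theorem periodic_halfCot : Function.Periodic halfCot (2 * π) := fun w => by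
  rw [halfCot, halfCot, Complex.cot_eq_cos_div_sin, Complex.cot_eq_cos_div_sin,
    show (w + 2 * π) / 2 = w / 2 + π by ring, Complex.sin_add_pi, Complex.cos_add_pi,
    neg_div_neg_eq]

section Periodization

variable {w : ℝ → ℂ} {p : ℂ} {β B c : ℝ}

theorem map_add_two_pi_mul_int (hw : ∀ β, w (β + 2 * π) = w β + 2 * π) (m : ℤ) (β : ℝ) :
    w (β + 2 * π * m) = w β + 2 * π * m := by
  simpa [mul_comm] using
    AddConstMapClass.map_add_zsmul (⟨w, hw⟩ : AddConstMap ℝ ℂ (2 * π) (2 * π)) β m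

theorem map_add_two_pi_mul_succ (hw : ∀ β, w (β + 2 * π) = w β + 2 * π) (j : ℕ) (β : ℝ) :
    w (β + 2 * π * (j + 1)) = w β + 2 * π * (j + 1) := by
  exact_mod_cast map_add_two_pi_mul_int hw (j + 1) β

theorem map_sub_two_pi_mul_succ (hw : ∀ β, w (β + 2 * π) = w β + 2 * π) (j : ℕ) (β : ℝ) :
    w (β - 2 * π * (j + 1)) = w β - 2 * π * (j + 1) := by
  have h := map_add_two_pi_mul_int hw (-(j + 1)) β
  push_cast at h
  rwa [mul_neg, mul_neg, ← sub_eq_add_neg, ← sub_eq_add_neg] at h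

theorem pi_mul_abs_le_abs_add (hβ : |β| ≤ π) {m : ℤ} (hm : m ≠ 0) :
    π * |(m : ℝ)| ≤ |β + 2 * π * m| := by
  have hone : (1 : ℝ) ≤ |(m : ℝ)| := by exact_mod_cast Int.one_le_abs hm
  have htri := abs_sub_abs_le_abs_sub (2 * π * m) (-β)
  rw [sub_neg_eq_add, add_comm _ β, abs_neg, abs_mul, abs_of_pos Real.two_pi_pos] at htri
  nlinarith [Real.pi_pos]

theorem add_two_pi_mul_int_ne_zero (hβ : |β| ≤ π) (hβ0 : β ≠ 0) (m : ℤ) :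
    β + 2 * π * m ≠ 0 := by
  rcases eq_or_ne m 0 with rfl | hm
  · simpa using hβ0
  · refine abs_pos.1 (lt_of_lt_of_le ?_ (pi_mul_abs_le_abs_add hβ hm))
    positivity

theorem norm_one_div_add_one_div_le {a b : ℂ} {r : ℝ} (hr : 0 < r) (ha : r ≤ ‖a‖) (hb : r ≤ ‖b‖) :
    ‖1 / a + 1 / b‖ ≤ ‖a + b‖ / r ^ 2 := by
  have ha0 : a ≠ 0 := norm_pos_iff.1 (hr.trans_le ha)
  have hb0 : b ≠ 0 := norm_pos_iff.1 (hr.trans_le hb)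
  rw [one_div_add_one_div ha0 hb0, norm_div, norm_mul, sq]
  gcongr

theorem tendsto_periodSum_im_div (hw : ∀ β, w (β + 2 * π) = w β + 2 * π)
    (hne : ∀ m : ℤ, w (β + 2 * π * m) ≠ 0) :
    Tendsto (fun n => periodSum π (fun β => (p / w β).im) n β) atTop
      (𝓝 (p * halfCot (w β)).im) := by
  have hsum := Complex.hasSum_im ((hasSum_halfCot fun m =>
    map_add_two_pi_mul_int hw m β ▸ hne m).mul_left p)
  have htendsto := hsum.tendsto_sum_nat.const_add (p / w β).im
  rw [mul_sub, Complex.sub_im, mul_one_div, add_sub_cancel] at htendsto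
  refine htendsto.congr fun n => congrArg ((p / w β).im + ·) (Finset.sum_congr rfl fun j _ => ?_)
  beta_reduce
  rw [map_add_two_pi_mul_succ hw, map_sub_two_pi_mul_succ hw, mul_add p, Complex.add_im,
    mul_one_div, mul_one_div]

/-- Pairing the translates by `±2π(j + 1)` cancels the nonsummable part of `p / w`. -/
theorem abs_im_div_add_im_div_le (hw : ∀ β, w (β + 2 * π) = w β + 2 * π) (hc : 0 < c)
    (hlow : ∀ β, c * |β| ≤ ‖w β‖) (hβ : |β| ≤ π) (j : ℕ) :
    |(p / w (β + 2 * π * (j + 1))).im + (p / w (β - 2 * π * (j + 1))).im| ≤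
      ‖p‖ * (2 * ‖w β‖ / (c * π) ^ 2) * (1 / ((j : ℝ) + 1) ^ 2) := by
  have hlow' (m : ℤ) (hm : m ≠ 0) : c * π * |(m : ℝ)| ≤ ‖w (β + 2 * π * m)‖ := by
    rw [mul_assoc]
    exact (mul_le_mul_of_nonneg_left (pi_mul_abs_le_abs_add hβ hm) hc.le).trans (hlow _)
  have habs : |(j : ℝ) + 1| = j + 1 := abs_of_pos (by positivity)
  have hplus : c * π * (j + 1) ≤ ‖w (β + 2 * π * (j + 1))‖ := by
    have h := hlow' (j + 1) (by lia)
    push_cast at h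
    rwa [habs] at h
  have hminus : c * π * (j + 1) ≤ ‖w (β - 2 * π * (j + 1))‖ := by
    have h := hlow' (-(j + 1)) (by lia)
    push_cast at h
    rwa [abs_neg, habs, mul_neg, ← sub_eq_add_neg] at h
  have hsum : w (β + 2 * π * (j + 1)) + w (β - 2 * π * (j + 1)) = 2 * w β := by
    rw [map_add_two_pi_mul_succ hw, map_sub_two_pi_mul_succ hw]
    ring
  calc _ ≤ ‖p‖ * ‖1 / w (β + 2 * π * (j + 1)) + 1 / w (β - 2 * π * (j + 1))‖ := by
        rw [← Complex.add_im, ← norm_mul, mul_add p, mul_one_div, mul_one_div]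
        exact Complex.abs_im_le_norm _
    _ ≤ ‖p‖ * (2 * ‖w β‖ / (c * π * (j + 1)) ^ 2) := by
        gcongr
        refine (norm_one_div_add_one_div_le (by positivity) hplus hminus).trans_eq ?_
        rw [hsum, norm_mul, Complex.norm_two]
    _ = _ := by rw [mul_pow (c * π), mul_one_div, mul_div_assoc, ← div_div]; ring

theorem exists_abs_periodSum_im_div_le (hwc : Continuous w)
    (hw : ∀ β, w (β + 2 * π) = w β + 2 * π) (hc : 0 < c) (hlow : ∀ β, c * |β| ≤ ‖w β‖)
    (hB : ∀ β, |(p / w β).im| ≤ B) :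
    ∃ M, ∀ n, ∀ β ∈ Set.Ioc (-π) π, |periodSum π (fun β => (p / w β).im) n β| ≤ M := by
  obtain ⟨W, hW⟩ := (isCompact_Icc (a := -π) (b := π)).exists_bound_of_continuousOn
    hwc.continuousOn
  have hsummable : Summable fun j : ℕ => 1 / ((j : ℝ) + 1) ^ 2 := by
    exact_mod_cast (summable_nat_add_iff 1).2 (Real.summable_one_div_nat_pow.2 one_lt_two)
  have hW0 : 0 ≤ W := (norm_nonneg _).trans (hW 0 ⟨by simp [Real.pi_nonneg], Real.pi_nonneg⟩)
  refine ⟨B + ∑' j : ℕ, ‖p‖ * (2 * W / (c * π) ^ 2) * (1 / ((j : ℝ) + 1) ^ 2),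
    fun n β hβ => (abs_add_le _ _).trans (add_le_add (hB β) ?_)⟩
  refine (Finset.abs_sum_le_sum_abs _ _).trans ((Finset.sum_le_sum fun j _ => ?_).trans
    ((hsummable.mul_left _).sum_le_tsum (Finset.range n) fun j _ => by positivity))
  refine (abs_im_div_add_im_div_le hw hc hlow (abs_le.2 ⟨hβ.1.le, hβ.2⟩) j).trans ?_
  gcongr
  exact hW β (Set.Ioc_subset_Icc_self hβ)

theorem hasPV_im_div_mul {v : ℝ → ℝ} (hwc : Continuous w)
    (hw : ∀ β, w (β + 2 * π) = w β + 2 * π) (hc : 0 < c) (hlow : ∀ β, c * |β| ≤ ‖w β‖)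
    (hB : ∀ β, |(p / w β).im| ≤ B) (hv : Function.Periodic v (2 * π))
    (hvi : ∀ a b, IntervalIntegrable v volume a b) :
    HasPV (fun β => (p / w β).im * v β) (∫ β in (-π)..π, (p * halfCot (w β)).im * v β) := by
  obtain ⟨M, hM⟩ := exists_abs_periodSum_im_div_le hwc hw hc hlow hB
  refine hasPV_mul_of_tendsto_periodSum (C := ‖p‖ / c) Real.pi_pos hv hvi
    (Complex.measurable_im.comp (measurable_const.div hwc.measurable)) hB (fun β => ?_) hM
    fun β hβ hβ0 => tendsto_periodSum_im_div hw fun m => ?_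
  · rw [le_div_iff₀ hc]
    calc |(p / w β).im| * |β| * c = |(p / w β).im| * (c * |β|) := by ring
      _ ≤ ‖p / w β‖ * ‖w β‖ := by
          gcongr
          · exact Complex.abs_im_le_norm _
          · exact hlow β
      _ ≤ ‖p‖ := by
          rw [norm_div]
          exact mul_le_of_le_div₀ (norm_nonneg _) (norm_nonneg _) le_rfl
  · have hne := add_two_pi_mul_int_ne_zero (abs_le.2 ⟨hβ.1.le, hβ.2⟩) hβ0 m
    exact norm_pos_iff.1 (lt_of_lt_of_le (by positivity) (hlow _))

end Periodization

/-! ### Bounds for the periodized Cauchy kernel -/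

/-- The derivative `-1 / (4 sin²(w/2))` of `halfCot`. -/
noncomputable def halfCotDeriv (w : ℂ) : ℂ := -1 / (4 * Complex.sin (w / 2) ^ 2)

theorem periodic_halfCotDeriv : Function.Periodic halfCotDeriv (2 * π) := fun w => by
  rw [halfCotDeriv, halfCotDeriv, show (w + 2 * π) / 2 = w / 2 + π by ring, Complex.sin_add_pi,
    neg_sq]

theorem norm_sin_sub_le {v : ℂ} (hv : ‖v‖ ≤ 1) : ‖Complex.sin v - v‖ ≤ ‖v‖ ^ 3 := by
  have hcubic : ‖v ^ 3 / 6‖ = ‖v‖ ^ 3 / 6 := by rw [norm_div, norm_pow]; norm_num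
  have hquintic : ‖v‖ ^ 5 ≤ ‖v‖ ^ 3 := pow_le_pow_of_le_one (norm_nonneg _) hv (by norm_num)
  calc ‖Complex.sin v - v‖ = ‖(Complex.sin v - (v - v ^ 3 / 6)) - v ^ 3 / 6‖ := by ring_nf
    _ ≤ ‖v‖ ^ 5 / 100 + ‖v‖ ^ 3 / 6 :=
        (norm_sub_le _ _).trans (add_le_add (Complex.sin_bound hv) hcubic.le)
    _ ≤ ‖v‖ ^ 3 := by linarith [pow_nonneg (norm_nonneg v) 3]

theorem norm_cos_sub_one_le {v : ℂ} (hv : ‖v‖ ≤ 1) : ‖Complex.cos v - 1‖ ≤ ‖v‖ ^ 2 := by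
  have hquadratic : ‖v ^ 2 / 2‖ = ‖v‖ ^ 2 / 2 := by rw [norm_div, norm_pow, Complex.norm_two]
  have hquartic : ‖v‖ ^ 4 ≤ ‖v‖ ^ 2 := pow_le_pow_of_le_one (norm_nonneg _) hv (by norm_num)
  calc ‖Complex.cos v - 1‖ = ‖(Complex.cos v - (1 - v ^ 2 / 2)) - v ^ 2 / 2‖ := by ring_nf
    _ ≤ ‖v‖ ^ 4 * (5 / 96) + ‖v‖ ^ 2 / 2 :=
        (norm_sub_le _ _).trans (add_le_add (Complex.cos_bound hv) hquadratic.le)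
    _ ≤ ‖v‖ ^ 2 := by linarith [sq_nonneg ‖v‖]

theorem sq_norm_sin (v : ℂ) :
    ‖Complex.sin v‖ ^ 2 = Real.sin v.re ^ 2 + Real.sinh v.im ^ 2 := by
  rw [← Complex.normSq_eq_norm_sq, Complex.sin_eq v, Complex.normSq_apply]
  simp only [← Complex.ofReal_sin, ← Complex.ofReal_cos, ← Complex.ofReal_sinh,
    ← Complex.ofReal_cosh, Complex.add_re, Complex.add_im, Complex.mul_re, Complex.mul_im,
    Complex.ofReal_re, Complex.ofReal_im, Complex.I_re, Complex.I_im]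
  linear_combination Real.sin v.re ^ 2 * Real.cosh_sq v.im +
    Real.sinh v.im ^ 2 * Real.sin_sq_add_cos_sq v.re

theorem norm_cos_le (v : ℂ) : ‖Complex.cos v‖ ≤ 1 + ‖Complex.sin v‖ := by
  refine le_of_sq_le_sq ?_ (by positivity)
  calc ‖Complex.cos v‖ ^ 2 = ‖1 - Complex.sin v ^ 2‖ := by
        rw [← norm_pow, Complex.cos_sq']
    _ ≤ 1 + ‖Complex.sin v‖ ^ 2 := by
        rw [← norm_pow, ← norm_one (α := ℂ)]
        exact norm_sub_le _ _
    _ ≤ (1 + ‖Complex.sin v‖) ^ 2 := by nlinarith [norm_nonneg (Complex.sin v)]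

section HalfCot

variable {w : ℂ} {ρ : ℝ}

theorem hasDerivAt_halfCot (hw : Complex.sin (w / 2) ≠ 0) :
    HasDerivAt halfCot (halfCotDeriv w) w := by
  have hhalf : HasDerivAt (fun v : ℂ => v / 2) (1 / 2) w := (hasDerivAt_id w).div_const 2
  have hquot := (hhalf.ccos.div hhalf.csin hw).div_const 2
  have hfun : halfCot = fun v => Complex.cos (v / 2) / Complex.sin (v / 2) / 2 :=
    funext fun v => by rw [halfCot, Complex.cot_eq_cos_div_sin]
  rw [hfun]
  refine hquot.congr_deriv ?_
  rw [halfCotDeriv]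
  field_simp
  linear_combination (-4) * Complex.sin_sq_add_cos_sq (w / 2)

theorem norm_le_pi_mul_norm_sin (hw : |w.re| ≤ π) : ‖w‖ ≤ π * ‖Complex.sin (w / 2)‖ := by
  refine le_of_sq_le_sq ?_ (by positivity)
  have hre : (2 / π * |w.re / 2|) ^ 2 ≤ Real.sin (w.re / 2) ^ 2 := by
    rw [← sq_abs (Real.sin _)]
    gcongr
    exact Real.mul_abs_le_abs_sin (by rw [abs_div, abs_two]; linarith)
  have him : |w.im / 2| ^ 2 ≤ Real.sinh (w.im / 2) ^ 2 := by
    rw [← sq_abs (Real.sinh _), Real.abs_sinh]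
    gcongr
    exact Real.self_le_sinh_iff.2 (abs_nonneg _)
  calc ‖w‖ ^ 2 = π ^ 2 * (2 / π * |w.re / 2|) ^ 2 + 2 ^ 2 * |w.im / 2| ^ 2 := by
        rw [← Complex.normSq_eq_norm_sq, Complex.normSq_apply, mul_pow, sq_abs, sq_abs]
        field_simp
    _ ≤ π ^ 2 * Real.sin (w.re / 2) ^ 2 + π ^ 2 * Real.sinh (w.im / 2) ^ 2 := by
        gcongr
        exact Real.two_le_pi
    _ = (π * ‖Complex.sin (w / 2)‖) ^ 2 := by
        rw [mul_pow, sq_norm_sin, mul_add, Complex.div_ofNat_re, Complex.div_ofNat_im]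

theorem exists_abs_re_add_le (w : ℂ) : ∃ m : ℤ, |(w + 2 * π * m).re| ≤ π := by
  refine ⟨-round (w.re / (2 * π)), ?_⟩
  have hre : (w + 2 * π * ((-round (w.re / (2 * π)) : ℤ) : ℂ)).re =
      2 * π * (w.re / (2 * π) - round (w.re / (2 * π))) := by
    rw [mul_sub, mul_div_cancel₀ _ Real.two_pi_pos.ne']
    simp [sub_eq_add_neg]
  rw [hre, abs_mul, abs_of_pos Real.two_pi_pos]
  nlinarith [abs_sub_round (w.re / (2 * π)), Real.pi_pos]

theorem norm_sin_add_int (w : ℂ) (m : ℤ) :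
    ‖Complex.sin ((w + 2 * π * m) / 2)‖ = ‖Complex.sin (w / 2)‖ := by
  rw [show (w + 2 * π * m) / 2 = w / 2 + m * π by ring,
    Complex.sin_antiperiodic.add_int_mul_eq]
  simp

theorem le_pi_mul_norm_sin (hw : ∀ m : ℤ, ρ ≤ ‖w + 2 * π * m‖) :
    ρ ≤ π * ‖Complex.sin (w / 2)‖ := by
  obtain ⟨m, hm⟩ := exists_abs_re_add_le w
  rw [← norm_sin_add_int w m]
  exact (hw m).trans (norm_le_pi_mul_norm_sin hm)

theorem norm_sin_half_pos (hρ : 0 < ρ) (hw : ∀ m : ℤ, ρ ≤ ‖w + 2 * π * m‖) :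
    0 < ‖Complex.sin (w / 2)‖ :=
  pos_of_mul_pos_right (hρ.trans_le (le_pi_mul_norm_sin hw)) Real.pi_nonneg

theorem norm_halfCot_le (hρ : 0 < ρ) (hρ1 : ρ ≤ 1) (hw : ∀ m : ℤ, ρ ≤ ‖w + 2 * π * m‖) :
    ‖halfCot w‖ ≤ 3 / ρ := by
  have hsin := norm_sin_half_pos hρ hw
  rw [halfCot, Complex.cot_eq_cos_div_sin, norm_div, norm_div, Complex.norm_two, div_div,
    div_le_div_iff₀ (by positivity) hρ]
  nlinarith [Real.pi_lt_four, norm_cos_le (w / 2), le_pi_mul_norm_sin hw]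

theorem norm_halfCotDeriv_le (hρ : 0 < ρ) (hw : ∀ m : ℤ, ρ ≤ ‖w + 2 * π * m‖) :
    ‖halfCotDeriv w‖ ≤ 3 / ρ ^ 2 := by
  have hsin := norm_sin_half_pos hρ hw
  rw [halfCotDeriv, norm_div, norm_neg, norm_one, norm_mul, norm_pow,
    show ‖(4 : ℂ)‖ = 4 by simp, div_le_div_iff₀ (by positivity) (by positivity), one_mul]
  calc ρ ^ 2 ≤ (π * ‖Complex.sin (w / 2)‖) ^ 2 := by
        gcongr
        exact le_pi_mul_norm_sin hw
    _ = π ^ 2 * ‖Complex.sin (w / 2)‖ ^ 2 := mul_pow _ _ _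
    _ ≤ 12 * ‖Complex.sin (w / 2)‖ ^ 2 := by
        gcongr
        nlinarith [Real.pi_lt_d2, Real.pi_pos]
    _ = 3 * (4 * ‖Complex.sin (w / 2)‖ ^ 2) := by ring

theorem norm_le_four_mul_norm_sin (hw : ‖w‖ ≤ 1) : ‖w‖ ≤ 4 * ‖Complex.sin (w / 2)‖ := by
  refine (norm_le_pi_mul_norm_sin ((Complex.abs_re_le_norm w).trans
    (hw.trans (by linarith [Real.pi_gt_three])))).trans ?_
  gcongr
  exact Real.pi_lt_four.le

theorem norm_two_mul_sin_sub_le (hw : ‖w‖ ≤ 1) :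
    ‖2 * Complex.sin (w / 2) - w‖ ≤ ‖w‖ ^ 3 / 4 := by
  have hhalf : ‖w / 2‖ = ‖w‖ / 2 := by rw [norm_div, Complex.norm_two]
  have h := norm_sin_sub_le (v := w / 2) (by rw [hhalf]; linarith)
  rw [show 2 * Complex.sin (w / 2) - w = 2 * (Complex.sin (w / 2) - w / 2) by ring, norm_mul,
    Complex.norm_two]
  rw [hhalf] at h
  linarith

theorem norm_halfCot_sub_inv_le_of_norm_le_one (hw0 : w ≠ 0) (hw : ‖w‖ ≤ 1) :
    ‖halfCot w - 1 / w‖ ≤ 2 * ‖w‖ := by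
  have hsin_le := norm_le_four_mul_norm_sin hw
  have hsin_pos : 0 < ‖Complex.sin (w / 2)‖ := by linarith [norm_pos_iff.2 hw0]
  have hsin : Complex.sin (w / 2) ≠ 0 := norm_pos_iff.1 hsin_pos
  have hcos := norm_cos_sub_one_le (v := w / 2) (by rw [norm_div, Complex.norm_two]; linarith)
  rw [norm_div, Complex.norm_two] at hcos
  have hquot : halfCot w - 1 / w = (w * (Complex.cos (w / 2) - 1) -
      (2 * Complex.sin (w / 2) - w)) / (2 * w * Complex.sin (w / 2)) := by
    rw [halfCot, Complex.cot_eq_cos_div_sin]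
    field_simp
    ring
  rw [hquot, norm_div, norm_mul, norm_mul, Complex.norm_two, div_le_iff₀ (by positivity)]
  calc ‖w * (Complex.cos (w / 2) - 1) - (2 * Complex.sin (w / 2) - w)‖
      ≤ ‖w‖ * (‖w‖ / 2) ^ 2 + ‖w‖ ^ 3 / 4 := by
        refine (norm_sub_le _ _).trans ?_
        rw [norm_mul]
        gcongr
        exact norm_two_mul_sin_sub_le hw
    _ = ‖w‖ ^ 2 * ‖w‖ / 2 := by ring
    _ ≤ ‖w‖ ^ 2 * (4 * ‖Complex.sin (w / 2)‖) / 2 := by gcongr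
    _ ≤ 2 * ‖w‖ * (2 * ‖w‖ * ‖Complex.sin (w / 2)‖) := by
        nlinarith [show 0 ≤ ‖w‖ ^ 2 * ‖Complex.sin (w / 2)‖ by positivity]

theorem norm_halfCotDeriv_add_le_of_norm_le_one (hw0 : w ≠ 0) (hw : ‖w‖ ≤ 1) :
    ‖halfCotDeriv w + 1 / w ^ 2‖ ≤ 4 := by
  have hsin_le := norm_le_four_mul_norm_sin hw
  have hsin_pos : 0 < ‖Complex.sin (w / 2)‖ := by linarith [norm_pos_iff.2 hw0]
  have hsin : Complex.sin (w / 2) ≠ 0 := norm_pos_iff.1 hsin_pos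
  have hdiff := norm_two_mul_sin_sub_le hw
  have hcube : ‖w‖ ^ 3 ≤ ‖w‖ := by
    simpa using pow_le_pow_of_le_one (norm_nonneg w) hw (by norm_num : 1 ≤ 3)
  have hquot : halfCotDeriv w + 1 / w ^ 2 = ((2 * Complex.sin (w / 2) - w) *
      ((2 * Complex.sin (w / 2) - w) + 2 * w)) / (4 * w ^ 2 * Complex.sin (w / 2) ^ 2) := by
    rw [halfCotDeriv]
    field_simp
    ring
  rw [hquot, norm_div, norm_mul, norm_mul, norm_mul, norm_pow, norm_pow,
    show ‖(4 : ℂ)‖ = 4 by simp, div_le_iff₀ (by positivity)]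
  calc ‖2 * Complex.sin (w / 2) - w‖ * ‖2 * Complex.sin (w / 2) - w + 2 * w‖
      ≤ (‖w‖ ^ 3 / 4) * (3 * ‖w‖) := by
        gcongr
        refine (norm_add_le _ _).trans ?_
        rw [norm_mul, Complex.norm_two]
        linarith [norm_nonneg w]
    _ = 3 / 4 * (‖w‖ ^ 2 * ‖w‖ ^ 2) := by ring
    _ ≤ 3 / 4 * (‖w‖ ^ 2 * (4 * ‖Complex.sin (w / 2)‖) ^ 2) := by gcongr
    _ ≤ 4 * (4 * ‖w‖ ^ 2 * ‖Complex.sin (w / 2)‖ ^ 2) := by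
        nlinarith [show 0 ≤ ‖w‖ ^ 2 * ‖Complex.sin (w / 2)‖ ^ 2 by positivity]

theorem le_norm_add_int_of_one_le_norm (h1 : 1 ≤ ‖w‖) (hρ1 : ρ ≤ 1)
    (hw : ∀ m : ℤ, m ≠ 0 → ρ ≤ ‖w + 2 * π * m‖) (m : ℤ) : ρ ≤ ‖w + 2 * π * m‖ := by
  rcases eq_or_ne m 0 with rfl | hm
  · simpa using hρ1.trans h1
  · exact hw m hm

theorem norm_halfCot_sub_inv_le (hw0 : w ≠ 0) (hρ : 0 < ρ) (hρ1 : ρ ≤ 1)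
    (hw : ∀ m : ℤ, m ≠ 0 → ρ ≤ ‖w + 2 * π * m‖) : ‖halfCot w - 1 / w‖ ≤ 4 / ρ := by
  have h1ρ : 1 ≤ 1 / ρ := (one_le_div hρ).2 hρ1
  rw [show 4 / ρ = 3 / ρ + 1 / ρ by ring]
  rcases le_total ‖w‖ 1 with h | h
  · refine (norm_halfCot_sub_inv_le_of_norm_le_one hw0 h).trans ?_
    rw [show 3 / ρ = 3 * (1 / ρ) by ring]
    linarith
  · refine (norm_sub_le _ _).trans (add_le_add
      (norm_halfCot_le hρ hρ1 (le_norm_add_int_of_one_le_norm h hρ1 hw)) ?_)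
    rw [norm_div, norm_one]
    exact one_div_le_one_div_of_le hρ (hρ1.trans h)

theorem norm_halfCotDeriv_add_le (hw0 : w ≠ 0) (hρ : 0 < ρ) (hρ1 : ρ ≤ 1)
    (hw : ∀ m : ℤ, m ≠ 0 → ρ ≤ ‖w + 2 * π * m‖) : ‖halfCotDeriv w + 1 / w ^ 2‖ ≤ 4 / ρ ^ 2 := by
  rcases le_total ‖w‖ 1 with h | h
  · refine (norm_halfCotDeriv_add_le_of_norm_le_one hw0 h).trans ?_
    exact le_div_self (by norm_num) (by positivity) (pow_le_one₀ hρ.le hρ1)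
  · rw [show 4 / ρ ^ 2 = 3 / ρ ^ 2 + 1 / ρ ^ 2 by ring]
    refine (norm_add_le _ _).trans (add_le_add
      (norm_halfCotDeriv_le hρ (le_norm_add_int_of_one_le_norm h hρ1 hw)) ?_)
    rw [norm_div, norm_one, norm_pow]
    exact one_div_le_one_div_of_le (by positivity) (by gcongr; exact hρ1.trans h)

theorem tendsto_halfCot_sub_inv : Tendsto (fun w => halfCot w - 1 / w) (𝓝[≠] 0) (𝓝 0) := by
  refine squeeze_zero_norm' (a := fun w => 2 * ‖w‖) ?_ ?_
  · filter_upwards [self_mem_nhdsWithin,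
      nhdsWithin_le_nhds (Metric.closedBall_mem_nhds (0 : ℂ) one_pos)] with w hw0 hw
    exact norm_halfCot_sub_inv_le_of_norm_le_one hw0 (mem_closedBall_zero_iff.1 hw)
  · exact (Continuous.tendsto' (by fun_prop) 0 0 (by simp)).mono_left nhdsWithin_le_nhds

end HalfCot

/-! ### Estimates for a single curve -/

/-- The norm `‖z‖_{C^{2,δ}}` as a real number. -/
noncomputable def curveNorm (δ : ℝ≥0) (z : ℝ → ℂ) : ℝ := (c2HolderNorm δ z).toReal

theorem periodic_deriv_of_add_const {f : ℝ → ℂ} {p : ℝ} {c : ℂ} (hf : ∀ α, f (α + p) = f α + c) :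
    Function.Periodic (deriv f) p := fun α => by
  rw [← deriv_comp_add_const, funext hf, deriv_add_const]

theorem iSup_enorm_ne_top_of_periodic {f : ℝ → ℂ} {p : ℝ} (hf : Continuous f)
    (hp : Function.Periodic f p) (hp0 : p ≠ 0) : (⨆ α, ‖f α‖ₑ) ≠ ⊤ := by
  obtain ⟨M, hM⟩ := (hp.isBounded_of_continuous hp0 hf).exists_norm_le
  refine ne_top_of_le_ne_top (ENNReal.ofReal_ne_top (r := M)) (iSup_le fun α => ?_)
  rw [← ofReal_norm]
  exact ENNReal.ofReal_le_ofReal (hM _ ⟨α, rfl⟩)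

theorem norm_sub_le_of_hasDerivAt {E : Type*} [NormedAddCommGroup E] [NormedSpace ℝ E]
    {f f' : ℝ → E} {C α γ : ℝ} (hf : ∀ s, HasDerivAt f (f' s) s)
    (hC : ∀ s, |s - α| ≤ |γ - α| → ‖f' s‖ ≤ C) : ‖f γ - f α‖ ≤ C * |γ - α| :=
  Convex.norm_image_sub_le_of_norm_hasDerivWithin_le (s := Set.uIcc α γ)
    (fun s _ => (hf s).hasDerivWithinAt) (fun s hs => hC s (Set.abs_sub_left_of_mem_uIcc hs))
    (convex_uIcc α γ) Set.left_mem_uIcc Set.right_mem_uIcc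

namespace IsC2HolderCurve

variable {δ : ℝ≥0} {z : ℝ → ℂ}

theorem contDiff_deriv (hz : IsC2HolderCurve δ z) : ContDiff ℝ 1 (deriv z) :=
  ((contDiff_succ_iff_deriv (n := 1)).1
    (by simpa only [one_add_one_eq_two] using hz.contDiff)).2.2

theorem hasDerivAt (hz : IsC2HolderCurve δ z) (α : ℝ) : HasDerivAt z (deriv z α) α :=
  (hz.contDiff.differentiable two_ne_zero α).hasDerivAt

theorem hasDerivAt_deriv (hz : IsC2HolderCurve δ z) (α : ℝ) :
    HasDerivAt (deriv z) (deriv (deriv z) α) α :=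
  (hz.contDiff_deriv.differentiable one_ne_zero α).hasDerivAt

theorem continuous (hz : IsC2HolderCurve δ z) : Continuous z := hz.contDiff.continuous

theorem continuous_deriv (hz : IsC2HolderCurve δ z) : Continuous (deriv z) :=
  hz.contDiff_deriv.continuous

theorem continuous_deriv_deriv (hz : IsC2HolderCurve δ z) : Continuous (deriv (deriv z)) :=
  (contDiff_one_iff_deriv.1 hz.contDiff_deriv).2

theorem periodic_deriv (hz : IsC2HolderCurve δ z) : Function.Periodic (deriv z) (2 * π) :=
  periodic_deriv_of_add_const hz.periodic

theorem periodic_deriv_deriv (hz : IsC2HolderCurve δ z) :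
    Function.Periodic (deriv (deriv z)) (2 * π) :=
  periodic_deriv_of_add_const (c := 0) fun α => by rw [hz.periodic_deriv α, add_zero]

theorem c2HolderNorm_ne_top (hz : IsC2HolderCurve δ z) : c2HolderNorm δ z ≠ ⊤ := by
  obtain ⟨M, hM⟩ := (isCompact_Icc (a := -π) (b := π)).exists_bound_of_continuousOn
    hz.continuous.continuousOn
  have hsup : (⨆ α ∈ Set.Icc (-π) π, ‖z α‖ₑ) ≠ ⊤ := by
    refine ne_top_of_le_ne_top (ENNReal.ofReal_ne_top (r := M)) (iSup₂_le fun α hα => ?_)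
    rw [← ofReal_norm]
    exact ENNReal.ofReal_le_ofReal (hM _ hα)
  rw [c2HolderNorm, ← hz.holder.coe_nnHolderNorm_eq_eHolderNorm]
  simp only [ne_eq, ENNReal.add_eq_top, ENNReal.coe_ne_top, or_false, not_or]
  exact ⟨⟨hsup, iSup_enorm_ne_top_of_periodic hz.continuous_deriv hz.periodic_deriv
    Real.two_pi_pos.ne'⟩, iSup_enorm_ne_top_of_periodic hz.continuous_deriv_deriv
    hz.periodic_deriv_deriv Real.two_pi_pos.ne'⟩

theorem norm_le_curveNorm (hz : IsC2HolderCurve δ z) {x : ℂ} (hx : ‖x‖ₑ ≤ c2HolderNorm δ z) :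
    ‖x‖ ≤ curveNorm δ z := by
  rw [← toReal_enorm]
  exact ENNReal.toReal_mono hz.c2HolderNorm_ne_top hx

theorem norm_deriv_le (hz : IsC2HolderCurve δ z) (α : ℝ) : ‖deriv z α‖ ≤ curveNorm δ z :=
  hz.norm_le_curveNorm ((le_iSup (fun α => ‖deriv z α‖ₑ) α).trans
    (le_add_right (le_add_right le_add_self)))

theorem norm_deriv_deriv_le (hz : IsC2HolderCurve δ z) (α : ℝ) :
    ‖deriv (deriv z) α‖ ≤ curveNorm δ z :=
  hz.norm_le_curveNorm ((le_iSup (fun α => ‖deriv (deriv z) α‖ₑ) α).trans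
    (le_add_right le_add_self))

theorem norm_deriv_deriv_sub_le (hz : IsC2HolderCurve δ z) (α γ : ℝ) :
    ‖deriv (deriv z) α - deriv (deriv z) γ‖ ≤ curveNorm δ z * |α - γ| ^ (δ : ℝ) := by
  have hconst : (nnHolderNorm δ (deriv (deriv z)) : ℝ) ≤ curveNorm δ z := by
    rw [← ENNReal.coe_toReal, hz.holder.coe_nnHolderNorm_eq_eHolderNorm]
    exact ENNReal.toReal_mono hz.c2HolderNorm_ne_top le_add_self
  have hdist := hz.holder.holderWith.dist_le α γ
  rw [dist_eq_norm, Real.dist_eq] at hdist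
  exact hdist.trans (by gcongr)

theorem one_le_curveNorm (hz : IsC2HolderCurve δ z) : 1 ≤ curveNorm δ z := by
  have hperiod := norm_sub_le_of_hasDerivAt (α := 0) (γ := 0 + 2 * π) hz.hasDerivAt
    fun s _ => hz.norm_deriv_le s
  rw [hz.periodic, add_sub_cancel_left, add_sub_cancel_left, norm_mul, Complex.norm_two,
    Complex.norm_real, Real.norm_eq_abs, abs_of_pos Real.pi_pos, abs_of_pos Real.two_pi_pos]
    at hperiod
  exact le_of_mul_le_mul_right (by rwa [one_mul]) Real.two_pi_pos

theorem curveNorm_nonneg (hz : IsC2HolderCurve δ z) : 0 ≤ curveNorm δ z :=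
  zero_le_one.trans hz.one_le_curveNorm

theorem norm_deriv_sub_le (hz : IsC2HolderCurve δ z) (α γ : ℝ) :
    ‖deriv z γ - deriv z α‖ ≤ curveNorm δ z * |γ - α| :=
  norm_sub_le_of_hasDerivAt hz.hasDerivAt_deriv fun s _ => hz.norm_deriv_deriv_le s

theorem norm_taylor_one_le (hz : IsC2HolderCurve δ z) (α γ : ℝ) :
    ‖z α - z γ - deriv z α * ((α - γ : ℝ) : ℂ)‖ ≤ curveNorm δ z * |α - γ| ^ 2 := by
  have hder (s : ℝ) : HasDerivAt (fun s : ℝ => z s - deriv z α * (s : ℂ))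
      (deriv z s - deriv z α) s :=
    ((hz.hasDerivAt s).sub (((hasDerivAt_id s).ofReal_comp).const_mul (deriv z α))).congr_deriv
      (by simp)
  have hbound := norm_sub_le_of_hasDerivAt (C := curveNorm δ z * |γ - α|) (γ := γ) hder
    fun s hs => (hz.norm_deriv_sub_le α s).trans
      (mul_le_mul_of_nonneg_left hs hz.curveNorm_nonneg)
  rw [norm_sub_rev, abs_sub_comm γ α] at hbound
  convert hbound using 1
  · congr 1
    push_cast
    ring
  · ring

theorem norm_deriv_taylor_le (hz : IsC2HolderCurve δ z) (α γ : ℝ) :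
    ‖deriv z γ - deriv z α - deriv (deriv z) α * ((γ - α : ℝ) : ℂ)‖ ≤
      curveNorm δ z * |γ - α| ^ (δ : ℝ) * |γ - α| := by
  have hder (s : ℝ) : HasDerivAt (fun s : ℝ => deriv z s - deriv (deriv z) α * (s : ℂ))
      (deriv (deriv z) s - deriv (deriv z) α) s :=
    ((hz.hasDerivAt_deriv s).sub
      (((hasDerivAt_id s).ofReal_comp).const_mul (deriv (deriv z) α))).congr_deriv (by simp)
  have hbound := norm_sub_le_of_hasDerivAt (C := curveNorm δ z * |γ - α| ^ (δ : ℝ)) (γ := γ) hder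
    fun s hs => (hz.norm_deriv_deriv_sub_le s α).trans (mul_le_mul_of_nonneg_left
      (Real.rpow_le_rpow (abs_nonneg _) hs δ.coe_nonneg) hz.curveNorm_nonneg)
  convert hbound using 1
  congr 1
  push_cast
  ring

theorem norm_taylor_two_le (hz : IsC2HolderCurve δ z) (α γ : ℝ) :
    ‖z α - z γ - deriv z α * ((α - γ : ℝ) : ℂ) + deriv (deriv z) α * ((α - γ : ℝ) : ℂ) ^ 2 / 2‖ ≤
      curveNorm δ z * |α - γ| ^ (δ : ℝ) * |α - γ| ^ 2 := by
  have hder (s : ℝ) : HasDerivAt (fun s : ℝ => z s + deriv z α * ((α - s : ℝ) : ℂ) -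
      deriv (deriv z) α * ((α - s : ℝ) : ℂ) ^ 2 / 2)
      (deriv z s - deriv z α - deriv (deriv z) α * ((s - α : ℝ) : ℂ)) s := by
    have hlin : HasDerivAt (fun s : ℝ => ((α - s : ℝ) : ℂ)) ((-1 : ℝ) : ℂ) s :=
      ((hasDerivAt_id s).const_sub α).ofReal_comp
    refine (((hz.hasDerivAt s).add (hlin.const_mul (deriv z α))).sub
      (((hlin.pow 2).const_mul (deriv (deriv z) α)).div_const 2)).congr_deriv ?_
    push_cast
    ring
  have hbound := norm_sub_le_of_hasDerivAt
    (C := curveNorm δ z * |γ - α| ^ (δ : ℝ) * |γ - α|) (γ := γ) hder fun s hs =>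
      (hz.norm_deriv_taylor_le α s).trans <| mul_le_mul (mul_le_mul_of_nonneg_left
        (Real.rpow_le_rpow (abs_nonneg _) hs δ.coe_nonneg) hz.curveNorm_nonneg) hs
        (abs_nonneg _) (mul_nonneg hz.curveNorm_nonneg (by positivity))
  rw [norm_sub_rev, abs_sub_comm γ α] at hbound
  convert hbound using 1
  · congr 1
    push_cast
    ring
  · ring

end IsC2HolderCurve

/-! ### The tangential kernel -/

/-- The periodized kernel `Im (∂x(α) · ½ cot ((x(α) - y(γ)) / 2))` of `π` times the operator
`u ↦ 2 BR(u, y)_x · ∂_α x`. -/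
noncomputable def kernel (x y : ℝ → ℂ) (α γ : ℝ) : ℝ :=
  (deriv x α * halfCot (x α - y γ)).im

/-- The derivative of `kernel x y` in its first variable. -/
noncomputable def kernelDeriv (x y : ℝ → ℂ) (α γ : ℝ) : ℝ :=
  (deriv (deriv x) α * halfCot (x α - y γ) + deriv x α ^ 2 * halfCotDeriv (x α - y γ)).im

section TwoCurves

variable {δ : ℝ≥0} {x y : ℝ → ℂ} {α γ s : ℝ}

theorem sin_half_sub_ne_zero (hy : ∀ γ, y (γ + 2 * π) = y γ + 2 * π)
    (hxy : ∀ m : ℤ, x α ≠ y (γ + 2 * π * m)) : Complex.sin ((x α - y γ) / 2) ≠ 0 := by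
  intro hsin
  obtain ⟨m, hm⟩ := Complex.sin_eq_zero_iff.1 hsin
  refine hxy m ?_
  rw [map_add_two_pi_mul_int hy]
  linear_combination 2 * hm

theorem hasDerivAt_kernel (hx : IsC2HolderCurve δ x)
    (hsin : Complex.sin ((x α - y γ) / 2) ≠ 0) :
    HasDerivAt (fun t => kernel x y t γ) (kernelDeriv x y α γ) α := by
  have hprod := (hx.hasDerivAt_deriv α).mul
    ((hasDerivAt_halfCot hsin).comp α ((hx.hasDerivAt α).sub_const (y γ)))
  refine (Complex.imCLM.hasFDerivAt.comp_hasDerivAt α hprod).congr_deriv ?_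
  simp only [kernelDeriv, Complex.imCLM_apply, Function.comp_apply]
  congr 1
  ring

theorem continuousAt_kernel (hx : IsC2HolderCurve δ x) (hy : Continuous y) {p : ℝ × ℝ}
    (hsin : Complex.sin ((x p.1 - y p.2) / 2) ≠ 0) :
    ContinuousAt (Function.uncurry (kernel x y)) p := by
  have := hx.continuous
  have hderiv := hx.continuous_deriv
  have hcot : ContinuousAt (fun q : ℝ × ℝ => halfCot (x q.1 - y q.2)) p :=
    (hasDerivAt_halfCot hsin).continuousAt.comp (f := fun q : ℝ × ℝ => x q.1 - y q.2)
      (by fun_prop)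
  exact Complex.continuous_im.continuousAt.comp
    (ContinuousAt.mul (f := fun q : ℝ × ℝ => deriv x q.1) (by fun_prop) hcot)

theorem continuousAt_kernelDeriv (hx : IsC2HolderCurve δ x) (hy : Continuous y) {p : ℝ × ℝ}
    (hsin : Complex.sin ((x p.1 - y p.2) / 2) ≠ 0) :
    ContinuousAt (Function.uncurry (kernelDeriv x y)) p := by
  have := hx.continuous
  have hderiv := hx.continuous_deriv
  have hderiv₂ := hx.continuous_deriv_deriv
  have hsub : ContinuousAt (fun q : ℝ × ℝ => x q.1 - y q.2) p := by fun_prop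
  have hcot : ContinuousAt (fun q : ℝ × ℝ => halfCot (x q.1 - y q.2)) p :=
    (hasDerivAt_halfCot hsin).continuousAt.comp (f := fun q : ℝ × ℝ => x q.1 - y q.2) hsub
  have hcotDeriv : ContinuousAt (fun q : ℝ × ℝ => halfCotDeriv (x q.1 - y q.2)) p := by
    unfold halfCotDeriv
    exact continuousAt_const.div (continuousAt_const.mul
      ((Complex.continuous_sin.continuousAt.comp (hsub.div_const 2)).pow 2)) (by simpa using hsin)
  exact Complex.continuous_im.continuousAt.comp
    ((ContinuousAt.mul (f := fun q : ℝ × ℝ => deriv (deriv x) q.1) (by fun_prop) hcot).add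
      (ContinuousAt.mul (f := fun q : ℝ × ℝ => deriv x q.1 ^ 2) (by fun_prop) hcotDeriv))

theorem one_div_le_norm_sub_add_int (hy : ∀ γ, y (γ + 2 * π) = y γ + 2 * π) (hs : 0 < s)
    (hsep : ∀ γ, 1 ≤ s * ‖x α - y γ‖) (m : ℤ) : 1 / s ≤ ‖x α - y γ + 2 * π * m‖ := by
  have hm := hsep (γ + 2 * π * (-m : ℤ))
  have hshift : x α - (y γ + 2 * π * ((-m : ℤ) : ℂ)) = x α - y γ + 2 * π * m := by
    push_cast
    ring
  rwa [map_add_two_pi_mul_int hy, hshift, ← div_le_iff₀' hs] at hm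

theorem abs_kernel_le (hx : IsC2HolderCurve δ x) (hy : ∀ γ, y (γ + 2 * π) = y γ + 2 * π)
    (hs : 1 ≤ s) (hsep : ∀ γ, 1 ≤ s * ‖x α - y γ‖) :
    |kernel x y α γ| ≤ 9 * s ^ 2 * curveNorm δ x ^ 2 := by
  have hs₀ : 0 < s := by linarith
  have hN := hx.curveNorm_nonneg
  have hcot : ‖halfCot (x α - y γ)‖ ≤ 3 * s := by
    simpa using norm_halfCot_le (by positivity) ((div_le_one hs₀).2 hs)
      (one_div_le_norm_sub_add_int hy hs₀ hsep)
  calc |kernel x y α γ| ≤ ‖deriv x α * halfCot (x α - y γ)‖ := Complex.abs_im_le_norm _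
    _ ≤ curveNorm δ x * (3 * s) := by
        rw [norm_mul]
        gcongr
        exact hx.norm_deriv_le α
    _ ≤ curveNorm δ x ^ 2 * (9 * s ^ 2) := by
        gcongr ?_ * ?_
        · exact le_self_pow₀ hx.one_le_curveNorm two_ne_zero
        · nlinarith
    _ = 9 * s ^ 2 * curveNorm δ x ^ 2 := mul_comm _ _

theorem abs_kernelDeriv_le (hx : IsC2HolderCurve δ x) (hy : ∀ γ, y (γ + 2 * π) = y γ + 2 * π)
    (hs : 1 ≤ s) (hsep : ∀ γ, 1 ≤ s * ‖x α - y γ‖) :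
    |kernelDeriv x y α γ| ≤ 9 * s ^ 2 * curveNorm δ x ^ 2 := by
  have hs₀ : 0 < s := by linarith
  have hN := hx.curveNorm_nonneg
  have hfar := one_div_le_norm_sub_add_int (γ := γ) hy hs₀ hsep
  have hcot : ‖halfCot (x α - y γ)‖ ≤ 3 * s := by
    simpa using norm_halfCot_le (by positivity) ((div_le_one hs₀).2 hs) hfar
  have hcotDeriv : ‖halfCotDeriv (x α - y γ)‖ ≤ 3 * s ^ 2 := by
    simpa using norm_halfCotDeriv_le (by positivity) hfar
  calc |kernelDeriv x y α γ|
      ≤ ‖deriv (deriv x) α * halfCot (x α - y γ) + deriv x α ^ 2 * halfCotDeriv (x α - y γ)‖ :=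
        Complex.abs_im_le_norm _
    _ ≤ curveNorm δ x * (3 * s) + curveNorm δ x ^ 2 * (3 * s ^ 2) := by
        refine (norm_add_le _ _).trans ?_
        rw [norm_mul, norm_mul, norm_pow]
        gcongr
        · exact hx.norm_deriv_deriv_le α
        · exact hx.norm_deriv_le α
    _ ≤ curveNorm δ x ^ 2 * (6 * s ^ 2) + curveNorm δ x ^ 2 * (3 * s ^ 2) := by
        gcongr ?_ * ?_ + _
        · exact le_self_pow₀ hx.one_le_curveNorm two_ne_zero
        · nlinarith
    _ = 9 * s ^ 2 * curveNorm δ x ^ 2 := by ring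

end TwoCurves

section TaylorQuotients

variable {p q d : ℂ} {t s N E : ℝ}

/-- The real singularity `1 / t` of `p / d` at `d ≈ p t` does not contribute to the imaginary
part; this is where the tangential projection gains a derivative. -/
theorem im_div_eq_im_taylor (ht : t ≠ 0) (hd : d ≠ 0) :
    (p / d).im = (-((d - p * t) / (t * d))).im := by
  have htc : (t : ℂ) ≠ 0 := Complex.ofReal_ne_zero.2 ht
  have hsplit : p / d = ((1 / t : ℝ) : ℂ) + -((d - p * t) / (t * d)) := by
    rw [Complex.ofReal_div, Complex.ofReal_one]
    field_simp
    ring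
  rw [hsplit, Complex.add_im, Complex.ofReal_im, zero_add]

theorem im_div_sub_sq_div_eq_im_taylor (ht : t ≠ 0) (hd : d ≠ 0) :
    (q / d - p ^ 2 / d ^ 2).im =
      (2 * (d - p * t + q * t ^ 2 / 2) / (t ^ 2 * d) - (d - p * t) ^ 2 / (t ^ 2 * d ^ 2)).im := by
  have htc : (t : ℂ) ≠ 0 := Complex.ofReal_ne_zero.2 ht
  have hsplit : q / d - p ^ 2 / d ^ 2 = ((-(1 / t ^ 2) : ℝ) : ℂ) +
      (2 * (d - p * t + q * t ^ 2 / 2) / (t ^ 2 * d) - (d - p * t) ^ 2 / (t ^ 2 * d ^ 2)) := by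
    rw [Complex.ofReal_neg, Complex.ofReal_div, Complex.ofReal_one, Complex.ofReal_pow]
    field_simp
    ring
  rw [hsplit, Complex.add_im, Complex.ofReal_im, zero_add]

theorem norm_inv_le_div (ht : t ≠ 0) (hd : |t| ≤ s * ‖d‖) (hd₀ : d ≠ 0) : ‖d‖⁻¹ ≤ s / |t| := by
  rwa [inv_eq_one_div, div_le_div_iff₀ (norm_pos_iff.2 hd₀) (abs_pos.2 ht), one_mul]

theorem abs_im_div_le (ht : t ≠ 0) (hd : |t| ≤ s * ‖d‖) (hd₀ : d ≠ 0)
    (htaylor : ‖d - p * t‖ ≤ N * |t| ^ 2) : |(p / d).im| ≤ N * s := by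
  have : 0 < |t| := abs_pos.2 ht
  have hN : 0 ≤ N * |t| ^ 2 := (norm_nonneg _).trans htaylor
  rw [im_div_eq_im_taylor ht hd₀]
  refine (Complex.abs_im_le_norm _).trans ?_
  rw [norm_neg, norm_div, norm_mul, Complex.norm_real, Real.norm_eq_abs, div_eq_mul_inv, mul_inv]
  calc ‖d - p * t‖ * (|t|⁻¹ * ‖d‖⁻¹) ≤ N * |t| ^ 2 * (|t|⁻¹ * (s / |t|)) := by
        gcongr
        exact norm_inv_le_div ht hd hd₀
    _ = N * s := by field_simp

theorem abs_im_div_sub_sq_div_le (ht : t ≠ 0) (hd : |t| ≤ s * ‖d‖) (hd₀ : d ≠ 0)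
    (htaylor : ‖d - p * t‖ ≤ N * |t| ^ 2) (htaylor₂ : ‖d - p * t + q * t ^ 2 / 2‖ ≤ E * |t| ^ 2) :
    |(q / d - p ^ 2 / d ^ 2).im| ≤ 2 * s * (E / |t|) + (N * s) ^ 2 := by
  have : 0 < |t| := abs_pos.2 ht
  have hinv := norm_inv_le_div ht hd hd₀
  have hE : 0 ≤ E * |t| ^ 2 := (norm_nonneg _).trans htaylor₂
  rw [im_div_sub_sq_div_eq_im_taylor ht hd₀]
  refine (Complex.abs_im_le_norm _).trans ((norm_sub_le _ _).trans (add_le_add ?_ ?_))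
  · rw [norm_div, norm_mul, norm_mul, norm_pow, Complex.norm_two, Complex.norm_real,
      Real.norm_eq_abs, div_eq_mul_inv, mul_inv]
    calc 2 * ‖d - p * t + q * t ^ 2 / 2‖ * ((|t| ^ 2)⁻¹ * ‖d‖⁻¹)
        ≤ 2 * (E * |t| ^ 2) * ((|t| ^ 2)⁻¹ * (s / |t|)) := by gcongr
      _ = 2 * s * (E / |t|) := by field_simp
  · rw [norm_div, norm_mul, norm_pow, norm_pow, norm_pow, Complex.norm_real, Real.norm_eq_abs,
      div_eq_mul_inv, mul_inv, ← inv_pow ‖d‖]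
    calc ‖d - p * t‖ ^ 2 * ((|t| ^ 2)⁻¹ * ‖d‖⁻¹ ^ 2)
        ≤ (N * |t| ^ 2) ^ 2 * ((|t| ^ 2)⁻¹ * (s / |t|) ^ 2) := by gcongr
      _ = (N * s) ^ 2 := by field_simp

end TaylorQuotients

theorem kernel_eq_add (x y : ℝ → ℂ) (α γ : ℝ) :
    kernel x y α γ = (deriv x α / (x α - y γ)).im +
      (deriv x α * (halfCot (x α - y γ) - 1 / (x α - y γ))).im := by
  rw [kernel, ← Complex.add_im]
  congr 1
  ring

theorem kernelDeriv_eq_add (x y : ℝ → ℂ) (α γ : ℝ) :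
    kernelDeriv x y α γ =
      (deriv (deriv x) α / (x α - y γ) - deriv x α ^ 2 / (x α - y γ) ^ 2).im +
      (deriv (deriv x) α * (halfCot (x α - y γ) - 1 / (x α - y γ)) +
        deriv x α ^ 2 * (halfCotDeriv (x α - y γ) + 1 / (x α - y γ) ^ 2)).im := by
  rw [kernelDeriv, ← Complex.add_im]
  congr 1
  ring

section OneCurve

variable {δ s : ℝ≥0} {z : ℝ → ℂ} {α γ : ℝ}

theorem abs_sub_le_of_antilipschitz (hs : AntilipschitzWith s z) (α γ : ℝ) :
    |α - γ| ≤ s * ‖z α - z γ‖ := by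
  simpa only [Real.dist_eq, Complex.dist_eq] using hs.le_mul_dist α γ

theorem one_le_of_antilipschitz (hz : ∀ γ, z (γ + 2 * π) = z γ + 2 * π)
    (hs : AntilipschitzWith s z) : 1 ≤ (s : ℝ) := by
  have hperiod := abs_sub_le_of_antilipschitz hs (0 + 2 * π) 0
  rw [hz, add_sub_cancel_left, add_sub_cancel_left, norm_mul, Complex.norm_two,
    Complex.norm_real, Real.norm_eq_abs, abs_of_pos Real.pi_pos, abs_of_pos Real.two_pi_pos]
    at hperiod
  exact le_of_mul_le_mul_right (by rwa [one_mul]) Real.two_pi_pos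

theorem sub_ne_zero_of_antilipschitz (hs : AntilipschitzWith s z) (h : α ≠ γ) : z α - z γ ≠ 0 :=
  sub_ne_zero.2 (hs.injective.ne h)

theorem abs_im_deriv_div_sub_le (hz : IsC2HolderCurve δ z) (hs : AntilipschitzWith s z)
    (α γ : ℝ) : |(deriv z α / (z α - z γ)).im| ≤ curveNorm δ z * s := by
  rcases eq_or_ne α γ with rfl | h
  · rw [sub_self, div_zero, Complex.zero_im, abs_zero]
    exact mul_nonneg hz.curveNorm_nonneg s.coe_nonneg
  · exact abs_im_div_le (sub_ne_zero.2 h) (abs_sub_le_of_antilipschitz hs α γ)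
      (sub_ne_zero_of_antilipschitz hs h) (hz.norm_taylor_one_le α γ)

theorem abs_im_deriv_deriv_div_sub_le (hz : IsC2HolderCurve δ z) (hs : AntilipschitzWith s z)
    (h : α ≠ γ) :
    |(deriv (deriv z) α / (z α - z γ) - deriv z α ^ 2 / (z α - z γ) ^ 2).im| ≤
      2 * (curveNorm δ z * s) * |α - γ| ^ ((δ : ℝ) - 1) + (curveNorm δ z * s) ^ 2 := by
  have hquot := abs_im_div_sub_sq_div_le (sub_ne_zero.2 h) (abs_sub_le_of_antilipschitz hs α γ)
    (sub_ne_zero_of_antilipschitz hs h) (hz.norm_taylor_one_le α γ) (hz.norm_taylor_two_le α γ)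
  rw [Real.rpow_sub_one (abs_pos.2 (sub_ne_zero.2 h)).ne']
  exact hquot.trans_eq (by ring)

theorem one_div_le_norm_add_int (hz : ∀ γ, z (γ + 2 * π) = z γ + 2 * π)
    (hs : AntilipschitzWith s z) (hαγ : |α - γ| ≤ π) {m : ℤ} (hm : m ≠ 0) :
    1 / s ≤ ‖z α - z γ + 2 * π * m‖ := by
  have hs₀ : (0 : ℝ) < s := zero_lt_one.trans_le (one_le_of_antilipschitz hz hs)
  have hdist := abs_sub_le_of_antilipschitz hs (α + 2 * π * m) γ
  rw [map_add_two_pi_mul_int hz, add_sub_right_comm, add_sub_right_comm] at hdist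
  rw [div_le_iff₀' hs₀]
  have hm₁ : (1 : ℝ) ≤ |(m : ℝ)| := by exact_mod_cast Int.one_le_abs hm
  nlinarith [pi_mul_abs_le_abs_add hαγ hm, Real.pi_gt_three]

theorem norm_halfCot_sub_inv_self_le (hz : ∀ γ, z (γ + 2 * π) = z γ + 2 * π)
    (hs : AntilipschitzWith s z) (hαγ : |α - γ| ≤ π) (h : α ≠ γ) :
    ‖halfCot (z α - z γ) - 1 / (z α - z γ)‖ ≤ 4 * s := by
  have hs₁ := one_le_of_antilipschitz hz hs
  simpa using norm_halfCot_sub_inv_le (ρ := 1 / s) (sub_ne_zero_of_antilipschitz hs h)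
    (by positivity) ((div_le_one (by positivity)).2 hs₁)
    fun m hm => one_div_le_norm_add_int hz hs hαγ hm

theorem norm_halfCotDeriv_add_self_le (hz : ∀ γ, z (γ + 2 * π) = z γ + 2 * π)
    (hs : AntilipschitzWith s z) (hαγ : |α - γ| ≤ π) (h : α ≠ γ) :
    ‖halfCotDeriv (z α - z γ) + 1 / (z α - z γ) ^ 2‖ ≤ 4 * (s : ℝ) ^ 2 := by
  have hs₁ := one_le_of_antilipschitz hz hs
  simpa using norm_halfCotDeriv_add_le (ρ := 1 / s) (sub_ne_zero_of_antilipschitz hs h)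
    (by positivity) ((div_le_one (by positivity)).2 hs₁)
    fun m hm => one_div_le_norm_add_int hz hs hαγ hm

theorem one_le_curveNorm_mul (hz : IsC2HolderCurve δ z) (hs : AntilipschitzWith s z) :
    1 ≤ curveNorm δ z * s :=
  one_le_mul_of_one_le_of_one_le hz.one_le_curveNorm (one_le_of_antilipschitz hz.periodic hs)

theorem abs_kernel_self_le (hz : IsC2HolderCurve δ z) (hs : AntilipschitzWith s z)
    (hαγ : |α - γ| ≤ π) (h : α ≠ γ) :
    |kernel z z α γ| ≤ 9 * (s : ℝ) ^ 2 * curveNorm δ z ^ 2 := by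
  have hN := hz.curveNorm_nonneg
  calc |kernel z z α γ|
      ≤ curveNorm δ z * s + curveNorm δ z * (4 * s) := by
        rw [kernel_eq_add]
        refine (abs_add_le _ _).trans (add_le_add (abs_im_deriv_div_sub_le hz hs α γ)
          ((Complex.abs_im_le_norm _).trans ?_))
        rw [norm_mul]
        gcongr
        · exact hz.norm_deriv_le α
        · exact norm_halfCot_sub_inv_self_le hz.periodic hs hαγ h
    _ ≤ 9 * (s : ℝ) ^ 2 * curveNorm δ z ^ 2 := by
        nlinarith [one_le_curveNorm_mul hz hs]

theorem abs_kernelDeriv_self_le (hz : IsC2HolderCurve δ z) (hs : AntilipschitzWith s z)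
    (hαγ : |α - γ| ≤ π) (h : α ≠ γ) :
    |kernelDeriv z z α γ| ≤
      9 * (s : ℝ) ^ 2 * curveNorm δ z ^ 2 * (1 + |α - γ| ^ ((δ : ℝ) - 1)) := by
  have hN := hz.curveNorm_nonneg
  have hsingular := abs_im_deriv_deriv_div_sub_le hz hs h
  have hregular : |(deriv (deriv z) α * (halfCot (z α - z γ) - 1 / (z α - z γ)) +
      deriv z α ^ 2 * (halfCotDeriv (z α - z γ) + 1 / (z α - z γ) ^ 2)).im| ≤
      curveNorm δ z * (4 * s) + curveNorm δ z ^ 2 * (4 * (s : ℝ) ^ 2) := by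
    refine (Complex.abs_im_le_norm _).trans ((norm_add_le _ _).trans ?_)
    rw [norm_mul, norm_mul, norm_pow]
    gcongr
    · exact hz.norm_deriv_deriv_le α
    · exact norm_halfCot_sub_inv_self_le hz.periodic hs hαγ h
    · exact hz.norm_deriv_le α
    · exact norm_halfCotDeriv_add_self_le hz.periodic hs hαγ h
  rw [kernelDeriv_eq_add]
  refine (abs_add_le _ _).trans ((add_le_add hsingular hregular).trans ?_)
  have hNs : curveNorm δ z * s ≤ (curveNorm δ z * s) ^ 2 :=
    le_self_pow₀ (one_le_curveNorm_mul hz hs) two_ne_zero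
  have hNs' := mul_le_mul_of_nonneg_right hNs
    (Real.rpow_nonneg (abs_nonneg (α - γ)) ((δ : ℝ) - 1))
  have hpow : 0 ≤ (curveNorm δ z * s) ^ 2 * |α - γ| ^ ((δ : ℝ) - 1) := by positivity
  nlinarith

theorem tendsto_div_sub_nhdsNE (hz : IsC2HolderCurve δ z) (γ : ℝ) :
    Tendsto (fun α : ℝ => (z α - z γ) / ((α - γ : ℝ) : ℂ)) (𝓝[≠] γ) (𝓝 (deriv z γ)) := by
  refine (hasDerivAt_iff_tendsto_slope.1 (hz.hasDerivAt γ)).congr fun α => ?_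
  rw [slope_def_module, Complex.real_smul, div_eq_inv_mul, Complex.ofReal_inv]

theorem deriv_ne_zero_of_antilipschitz (hz : IsC2HolderCurve δ z) (hs : AntilipschitzWith s z)
    (γ : ℝ) : deriv z γ ≠ 0 := by
  have hs₀ : (0 : ℝ) < s := zero_lt_one.trans_le (one_le_of_antilipschitz hz.periodic hs)
  have hlow : (s : ℝ)⁻¹ ≤ ‖deriv z γ‖ := by
    refine ge_of_tendsto (tendsto_div_sub_nhdsNE hz γ).norm ?_
    filter_upwards [self_mem_nhdsWithin] with α hα
    rw [norm_div, Complex.norm_real, Real.norm_eq_abs,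
      le_div_iff₀ (abs_pos.2 (sub_ne_zero.2 hα)), inv_mul_le_iff₀ hs₀]
    exact abs_sub_le_of_antilipschitz hs α γ
  exact norm_pos_iff.1 ((inv_pos.2 hs₀).trans_le hlow)

theorem tendsto_taylor_two_div (hz : IsC2HolderCurve δ z) (hδ : 0 < δ) (γ : ℝ) :
    Tendsto (fun α : ℝ => (z α - z γ - deriv z α * ((α - γ : ℝ) : ℂ) +
      deriv (deriv z) α * ((α - γ : ℝ) : ℂ) ^ 2 / 2) / ((α - γ : ℝ) : ℂ) ^ 2)
      (𝓝[≠] γ) (𝓝 0) := by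
  have hδ' : (0 : ℝ) < δ := hδ
  have hbound : Tendsto (fun α : ℝ => curveNorm δ z * |α - γ| ^ (δ : ℝ)) (𝓝[≠] γ) (𝓝 0) :=
    ((Continuous.tendsto' (continuous_const.mul ((continuous_id.sub continuous_const).abs.rpow_const
      fun _ => Or.inr hδ'.le)) γ 0 (by simp [hδ'.ne'])).mono_left nhdsWithin_le_nhds)
  refine squeeze_zero_norm' ?_ hbound
  filter_upwards [self_mem_nhdsWithin] with α hα
  have ht : 0 < |α - γ| := abs_pos.2 (sub_ne_zero.2 hα)
  rw [norm_div, norm_pow, Complex.norm_real, Real.norm_eq_abs, div_le_iff₀ (by positivity)]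
  exact hz.norm_taylor_two_le α γ

theorem tendsto_im_deriv_div_sub (hz : IsC2HolderCurve δ z) (hδ : 0 < δ)
    (hs : AntilipschitzWith s z) (γ : ℝ) :
    Tendsto (fun α => (deriv z α / (z α - z γ)).im) (𝓝[≠] γ)
      (𝓝 ((deriv (deriv z) γ / 2 - 0) / deriv z γ).im) := by
  have hderiv₂ : Tendsto (deriv (deriv z)) (𝓝[≠] γ) (𝓝 (deriv (deriv z) γ)) :=
    (hz.continuous_deriv_deriv.tendsto γ).mono_left nhdsWithin_le_nhds
  have hquot := ((hderiv₂.div_const 2).sub (tendsto_taylor_two_div hz hδ γ)).div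
    (tendsto_div_sub_nhdsNE hz γ) (deriv_ne_zero_of_antilipschitz hz hs γ)
  refine ((Complex.continuous_im.tendsto _).comp hquot).congr' ?_
  filter_upwards [self_mem_nhdsWithin] with α hα
  have hd := sub_ne_zero_of_antilipschitz hs hα
  have htc : ((α - γ : ℝ) : ℂ) ≠ 0 := Complex.ofReal_ne_zero.2 (sub_ne_zero.2 hα)
  rw [im_div_eq_im_taylor (sub_ne_zero.2 hα) hd, Function.comp_apply]
  congr 1
  simp only [Pi.div_apply]
  generalize z α - z γ = d at *
  generalize ((α - γ : ℝ) : ℂ) = t at *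
  field_simp
  ring

theorem exists_tendsto_kernel_self (hz : IsC2HolderCurve δ z) (hδ : 0 < δ)
    (hs : AntilipschitzWith s z) (γ : ℝ) :
    ∃ l, Tendsto (fun α => kernel z z α γ) (𝓝[≠] γ) (𝓝 l) := by
  have hsub : Tendsto (fun α => z α - z γ) (𝓝[≠] γ) (𝓝[≠] 0) :=
    tendsto_nhdsWithin_iff.2 ⟨((hz.continuous.sub continuous_const).tendsto' γ 0
      (by simp)).mono_left nhdsWithin_le_nhds,
      eventually_mem_of_tendsto_nhdsWithin tendsto_id |>.mono fun α hα =>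
        sub_ne_zero_of_antilipschitz hs hα⟩
  have hderiv : Tendsto (deriv z) (𝓝[≠] γ) (𝓝 (deriv z γ)) :=
    (hz.continuous_deriv.tendsto γ).mono_left nhdsWithin_le_nhds
  have hregular := (Complex.continuous_im.tendsto _).comp
    (hderiv.mul (tendsto_halfCot_sub_inv.comp hsub))
  exact ⟨_, ((tendsto_im_deriv_div_sub hz hδ hs γ).add hregular).congr
    fun α => (kernel_eq_add z z α γ).symm⟩

end OneCurve

/-! ### Doubly periodic kernels on the circle -/

section Circle

variable {T : ℝ}

theorem periodic_coe_sub {X : Type*} (f : AddCircle T → X) (α : ℝ) :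
    Function.Periodic (fun β : ℝ => f ((α - β : ℝ) : AddCircle T)) T := fun β => by
  beta_reduce
  rw [← sub_sub, AddCircle.coe_sub, AddCircle.coe_period, sub_zero]

theorem nhdsNE_coe_addCircle_le_map (γ : ℝ) :
    𝓝[≠] (γ : AddCircle T) ≤ map (fun t : ℝ => (t : AddCircle T)) (𝓝[≠] γ) := by
  intro S hS
  have hnhds : 𝓝 (γ : AddCircle T) = map (fun t : ℝ => (t : AddCircle T)) (𝓝 γ) :=
    (QuotientAddGroup.isOpenQuotientMap_mk.map_nhds_eq γ).symm
  rw [mem_map, mem_nhdsWithin_iff_eventually] at hS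
  rw [mem_nhdsWithin_iff_eventually, hnhds, eventually_map]
  exact hS.mono fun s hs hne => hs fun hsγ => hne (congrArg _ hsγ)

variable [hT : Fact (0 < T)]

theorem intervalIntegrable_coe_sub {E : Type*} [NormedAddCommGroup E] {f : AddCircle T → E}
    (hf : Integrable f) (α a b : ℝ) :
    IntervalIntegrable (fun β : ℝ => f ((α - β : ℝ) : AddCircle T)) volume a b := by
  have hT₀ : 0 < T := hT.out
  have hper : Function.Periodic (fun γ : ℝ => f γ) T := fun γ =>
    congrArg f (AddCircle.coe_add_period T γ)
  have hbase : IntervalIntegrable (fun γ : ℝ => f γ) volume 0 (0 + T) := by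
    rw [intervalIntegrable_iff_integrableOn_Ioc_of_le (by linarith)]
    exact (AddCircle.measurePreserving_mk T 0).integrable_comp_of_integrable hf
  rw [zero_add] at hbase
  simpa only [sub_sub_cancel] using
    (hper.intervalIntegrable₀ hT₀.ne' hbase (α - a) (α - b)).comp_sub_left α

theorem ae_coe_of_ae {P : AddCircle T → Prop} (h : ∀ᵐ a, P a) :
    ∀ᵐ α : ℝ, P (α : AddCircle T) := by
  rw [← Measure.restrict_univ (μ := (volume : Measure ℝ)), ← iUnion_Ioc_add_zsmul hT.out 0,
    ae_restrict_iUnion_iff]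
  intro n
  have hn := (AddCircle.measurePreserving_mk T (0 + n • T)).quasiMeasurePreserving.ae h
  rwa [add_assoc, ← add_one_zsmul] at hn

theorem integral_addCircle_eq {E : Type*} [NormedAddCommGroup E] [NormedSpace ℝ E]
    (f : AddCircle T → E) (a α : ℝ) :
    ∫ c, f c = ∫ β in a..a + T, f ((α - β : ℝ) : AddCircle T) := by
  rw [intervalIntegral.integral_comp_sub_left (fun γ : ℝ => f (γ : AddCircle T)) α,
    ← AddCircle.intervalIntegral_preimage T (α - (a + T)) f, ← sub_sub, sub_add_cancel]

theorem exists_coe_eq_abs_le (t : AddCircle T) : ∃ b : ℝ, (b : AddCircle T) = t ∧ |b| ≤ T / 2 := by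
  obtain ⟨b, hb, rfl⟩ : t ∈ ((↑) : ℝ → AddCircle T) '' Set.Ioc (-(T / 2)) (-(T / 2) + T) := by
    rw [AddCircle.coe_image_Ioc_eq]
    trivial
  exact ⟨b, rfl, abs_le.2 ⟨hb.1.le, by linarith [hb.2]⟩⟩

/-- Periodicity with period `T` in each of the two variables. -/
structure DoublyPeriodic (T : ℝ) (K : ℝ → ℝ → ℝ) : Prop where
  left : ∀ γ, Function.Periodic (fun α => K α γ) T
  right : ∀ α, Function.Periodic (K α) T

/-- The kernel on the circle induced by a doubly periodic kernel on the line. Representatives are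
taken in `(0, T]`, which makes measurability on the circle immediate. -/
noncomputable def torusLift (T : ℝ) [Fact (0 < T)] (K : ℝ → ℝ → ℝ) (a c : AddCircle T) : ℝ :=
  K (AddCircle.equivIoc T 0 a) (AddCircle.equivIoc T 0 c)

theorem measurable_torusLift {K : ℝ → ℝ → ℝ} (hK : Measurable (Function.uncurry K)) :
    Measurable (Function.uncurry (torusLift T K)) := by
  have hrep : Measurable fun a : AddCircle T => (AddCircle.equivIoc T 0 a : ℝ) :=
    measurable_subtype_coe.comp (AddCircle.measurableEquivIoc T 0).measurable
  exact hK.comp ((hrep.comp measurable_fst).prodMk (hrep.comp measurable_snd))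

namespace DoublyPeriodic

variable {K L : ℝ → ℝ → ℝ}

theorem torusLift_coe (hK : DoublyPeriodic T K) (α γ : ℝ) : torusLift T K α γ = K α γ := by
  have hrep {f : ℝ → ℝ} (hf : Function.Periodic f T) (t : ℝ) :
      f (AddCircle.equivIoc T 0 (t : AddCircle T)) = f t := by
    rw [← hf.lift_coe, ← hf.lift_coe, AddCircle.coe_equivIoc]
  rw [torusLift, hrep (hK.right _)]
  exact hrep (hK.left γ) α

theorem continuousAt_torusLift (hK : DoublyPeriodic T K) {α γ : ℝ}
    (h : ContinuousAt (Function.uncurry K) (α, γ)) :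
    ContinuousAt (Function.uncurry (torusLift T K)) ((α : AddCircle T), (γ : AddCircle T)) := by
  have hquot : IsOpenQuotientMap (Prod.map (fun t : ℝ => (t : AddCircle T))
      (fun t : ℝ => (t : AddCircle T))) :=
    QuotientAddGroup.isOpenQuotientMap_mk.prodMap QuotientAddGroup.isOpenQuotientMap_mk
  have hcomp : Function.uncurry (torusLift T K) ∘ Prod.map (fun t : ℝ => (t : AddCircle T))
      (fun t : ℝ => (t : AddCircle T)) = Function.uncurry K :=
    funext fun p => hK.torusLift_coe p.1 p.2
  exact (hquot.continuousAt_comp_iff (x := (α, γ))).1 (by rwa [hcomp])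

theorem isDominatedKernel_torusLift (hK : DoublyPeriodic T K) (hm : Measurable (Function.uncurry K))
    {w : AddCircle T → ℝ} (hw : Integrable w)
    (hle : ∀ α γ : ℝ, |α - γ| ≤ T / 2 → |K α γ| ≤ w ((α - γ : ℝ) : AddCircle T)) :
    IsDominatedKernel (torusLift T K) w volume where
  measurable := measurable_torusLift hm
  abs_le a c := by
    obtain ⟨γ, rfl⟩ := QuotientAddGroup.mk_surjective c
    obtain ⟨b, hb, hbT⟩ := exists_coe_eq_abs_le (a - (γ : AddCircle T))
    obtain rfl : ((γ + b : ℝ) : AddCircle T) = a := by rw [AddCircle.coe_add, hb, add_sub_cancel]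
    have hle' := hle (γ + b) γ (by rwa [add_sub_cancel_left])
    rwa [← hK.torusLift_coe] at hle'
  integrable := hw

theorem isKernelDeriv_torusLift (hK : DoublyPeriodic T K) (hL : DoublyPeriodic T L)
    (hderiv : ∀ α γ : ℝ, (α : AddCircle T) ≠ γ → HasDerivAt (fun t => K t γ) (L α γ) α)
    (hlim : ∀ γ, ∃ l, Tendsto (fun α => K α γ) (𝓝[≠] γ) (𝓝 l)) :
    IsKernelDeriv (torusLift T K) (torusLift T L) where
  hasDerivAt c t ht := by
    obtain ⟨γ, rfl⟩ := QuotientAddGroup.mk_surjective c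
    have hd := hderiv t γ ht
    simp only [← hK.torusLift_coe, ← hL.torusLift_coe] at hd
    exact hd
  exists_tendsto c := by
    obtain ⟨γ, rfl⟩ := QuotientAddGroup.mk_surjective c
    obtain ⟨l, hl⟩ := hlim γ
    simp only [← hK.torusLift_coe] at hl
    exact ⟨l, (tendsto_map'_iff.2 hl).mono_left (nhdsNE_coe_addCircle_le_map γ)⟩

end DoublyPeriodic

end Circle

/-! ### The tangential Birkhoff–Rott operators -/

section Weight

variable {T : ℝ}

/-- The weight `1 + ‖t‖ ^ (δ - 1)` on the circle, which dominates the derivatives of the tangential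
kernels of a `C^{2,δ}` curve. -/
noncomputable def weight (δ : ℝ) (t : AddCircle T) : ℝ := 1 + ‖t‖ ^ (δ - 1)

theorem one_le_weight (δ : ℝ) (t : AddCircle T) : 1 ≤ weight δ t :=
  le_add_of_nonneg_right (Real.rpow_nonneg (norm_nonneg t) _)

variable [hT : Fact (0 < T)]

theorem weight_coe (δ : ℝ) {t : ℝ} (ht : |t| ≤ T / 2) :
    weight δ (t : AddCircle T) = 1 + |t| ^ (δ - 1) := by
  rw [weight, (AddCircle.norm_coe_eq_abs_iff T hT.out.ne').2 (by rwa [abs_of_pos hT.out])]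

theorem integrable_weight {δ : ℝ} (hδ : 0 < δ) :
    Integrable (weight δ : AddCircle T → ℝ) := by
  have hT₀ : 0 < T := hT.out
  have hmeas : Measurable (weight δ : AddCircle T → ℝ) :=
    measurable_const.add (measurable_norm.pow_const _)
  have hpos : IntervalIntegrable (fun t : ℝ => |t| ^ (δ - 1)) volume 0 (T / 2) := by
    refine (intervalIntegral.intervalIntegrable_rpow' (r := δ - 1) (by linarith)).congr ?_
    intro t ht
    rw [Set.uIoc_of_le (by positivity)] at ht
    simp only [abs_of_pos ht.1]
  have hneg : IntervalIntegrable (fun t : ℝ => |t| ^ (δ - 1)) volume (-(T / 2)) 0 := by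
    rw [IntervalIntegrable.iff_comp_neg]
    simpa only [abs_neg, neg_neg, neg_zero] using hpos.symm
  have hle : -(T / 2) ≤ T / 2 := by linarith
  rw [← (AddCircle.measurePreserving_mk T (-(T / 2))).integrable_comp hmeas.aestronglyMeasurable,
    show -(T / 2) + T = T / 2 by ring]
  change IntegrableOn _ _ _
  rw [← intervalIntegrable_iff_integrableOn_Ioc_of_le hle]
  refine ((intervalIntegrable_const (c := (1 : ℝ))).add (hneg.trans hpos)).congr ?_
  intro t ht
  rw [Set.uIoc_of_le hle] at ht
  exact (weight_coe δ (abs_le.2 ⟨ht.1.le, ht.2⟩)).symm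

end Weight

section TangentialIntegrand

variable {x y : ℝ → ℂ} {α c B : ℝ}

theorem tangentialIntegrand_eq (y x : ℝ → ℂ) (u : L2) (α β : ℝ) :
    tangentialIntegrand y x u α β =
      (deriv x α / (x α - y (α - β))).im * u ((α - β : ℝ) : AddCircle (2 * π)) := by
  rw [tangentialIntegrand, brIntegrand, real_inner_smul_left, perp]
  generalize x α - y (α - β) = w
  generalize deriv x α = p
  rw [Complex.inner, Complex.div_im, ← Complex.normSq_eq_norm_sq]
  simp only [Complex.mul_re, Complex.mul_im, Complex.conj_re, Complex.conj_im, Complex.I_re,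
    Complex.I_im]
  ring

theorem hasPV_tangentialIntegrand (hy : Continuous y) (hper : ∀ γ, y (γ + 2 * π) = y γ + 2 * π)
    (hc : 0 < c) (hlow : ∀ β, c * |β| ≤ ‖x α - y (α - β)‖)
    (hB : ∀ β, |(deriv x α / (x α - y (α - β))).im| ≤ B) (u : L2) :
    HasPV (tangentialIntegrand y x u α)
      (∫ β in (-π)..π, kernel x y α (α - β) * u ((α - β : ℝ) : AddCircle (2 * π))) := by
  rw [funext (tangentialIntegrand_eq y x u α)]
  refine hasPV_im_div_mul (by fun_prop) (fun β => ?_) hc hlow hB (periodic_coe_sub u α)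
    (intervalIntegrable_coe_sub ((Lp.memLp u).integrable one_le_two) α)
  have hshift := hper (α - (β + 2 * π))
  rw [show α - (β + 2 * π) + 2 * π = α - β by ring] at hshift
  rw [hshift]
  ring

end TangentialIntegrand

theorem measurable_halfCot : Measurable halfCot := by
  unfold halfCot Complex.cot
  fun_prop

theorem measurable_halfCotDeriv : Measurable halfCotDeriv := by
  unfold halfCotDeriv
  fun_prop

/-- Conditions on a pair of curves under which the tangential Birkhoff–Rott operator of `y` on `x`
maps `L²` compactly to `H¹` with norm `O(M)`. They cover both a single arc-chord curve, where the
kernel is singular on the diagonal, and two separated curves, where it is smooth. -/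
structure IsAdmissiblePair (δ : ℝ≥0) (x y : ℝ → ℂ) (M : ℝ) : Prop where
  curve : IsC2HolderCurve δ x
  continuous_right : Continuous y
  add_two_pi_right : ∀ γ, y (γ + 2 * π) = y γ + 2 * π
  sin_ne_zero : ∀ α γ : ℝ, (α : AddCircle (2 * π)) ≠ γ → Complex.sin ((x α - y γ) / 2) ≠ 0
  abs_kernel_le : ∀ α γ : ℝ, |α - γ| ≤ π → |kernel x y α γ| ≤ M
  abs_kernelDeriv_le : ∀ α γ : ℝ, |α - γ| ≤ π →
    |kernelDeriv x y α γ| ≤ M * (1 + |α - γ| ^ ((δ : ℝ) - 1))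
  exists_tendsto : ∀ γ, ∃ l, Tendsto (fun α => kernel x y α γ) (𝓝[≠] γ) (𝓝 l)
  exists_lower : ∀ α, ∃ c > 0, ∀ β, c * |β| ≤ ‖x α - y (α - β)‖
  exists_upper : ∀ α, ∃ B, ∀ β, |(deriv x α / (x α - y (α - β))).im| ≤ B

namespace IsAdmissiblePair

variable {δ : ℝ≥0} {x y : ℝ → ℂ} {M : ℝ}

theorem hasPV (h : IsAdmissiblePair δ x y M) (u : L2) (α : ℝ) :
    HasPV (tangentialIntegrand y x u α)
      (∫ β in (-π)..π, kernel x y α (α - β) * u ((α - β : ℝ) : AddCircle (2 * π))) := by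
  obtain ⟨c, hc, hlow⟩ := h.exists_lower α
  obtain ⟨B, hB⟩ := h.exists_upper α
  exact hasPV_tangentialIntegrand h.continuous_right h.add_two_pi_right hc hlow hB u

theorem sub_eq_add_two_pi (h : IsAdmissiblePair δ x y M) (α γ : ℝ) :
    x (α + 2 * π) - y γ = x α - y γ + 2 * π := by
  rw [h.curve.periodic, add_sub_right_comm]

theorem sub_add_two_pi_eq (h : IsAdmissiblePair δ x y M) (α γ : ℝ) :
    x α - y (γ + 2 * π) = x α - y γ - 2 * π := by
  rw [h.add_two_pi_right, sub_sub]

theorem doublyPeriodic_kernel (h : IsAdmissiblePair δ x y M) :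
    DoublyPeriodic (2 * π) (kernel x y) where
  left γ α := by
    simp only [kernel, h.sub_eq_add_two_pi, periodic_halfCot _, h.curve.periodic_deriv α]
  right α γ := by
    simp only [kernel, h.sub_add_two_pi_eq, periodic_halfCot.sub_eq]

theorem doublyPeriodic_kernelDeriv (h : IsAdmissiblePair δ x y M) :
    DoublyPeriodic (2 * π) (kernelDeriv x y) where
  left γ α := by
    simp only [kernelDeriv, h.sub_eq_add_two_pi, periodic_halfCot _, periodic_halfCotDeriv _,
      h.curve.periodic_deriv α, h.curve.periodic_deriv_deriv α]
  right α γ := by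
    simp only [kernelDeriv, h.sub_add_two_pi_eq, periodic_halfCot.sub_eq,
      periodic_halfCotDeriv.sub_eq]

theorem measurable_sub (h : IsAdmissiblePair δ x y M) :
    Measurable fun p : ℝ × ℝ => x p.1 - y p.2 :=
  ((h.curve.continuous.comp continuous_fst).sub
    (h.continuous_right.comp continuous_snd)).measurable

theorem measurable_kernel (h : IsAdmissiblePair δ x y M) :
    Measurable (Function.uncurry (kernel x y)) :=
  Complex.measurable_im.comp (((measurable_deriv x).comp measurable_fst).mul
    (measurable_halfCot.comp h.measurable_sub))

theorem measurable_kernelDeriv (h : IsAdmissiblePair δ x y M) :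
    Measurable (Function.uncurry (kernelDeriv x y)) :=
  Complex.measurable_im.comp ((((measurable_deriv _).comp measurable_fst).mul
    (measurable_halfCot.comp h.measurable_sub)).add
    ((((measurable_deriv x).comp measurable_fst).pow_const 2).mul
      (measurable_halfCotDeriv.comp h.measurable_sub)))

theorem bound_nonneg (h : IsAdmissiblePair δ x y M) : 0 ≤ M :=
  (abs_nonneg _).trans (h.abs_kernel_le 0 0 (by simpa using Real.pi_pos.le))

theorem isDominatedKernel_kernel (h : IsAdmissiblePair δ x y M) (hδ : 0 < δ) :
    IsDominatedKernel (torusLift (2 * π) (kernel x y)) (fun t => M * weight δ t) volume :=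
  h.doublyPeriodic_kernel.isDominatedKernel_torusLift h.measurable_kernel
    ((integrable_weight (NNReal.coe_pos.2 hδ)).const_mul M) fun α γ hαγ => by
      rw [mul_div_cancel_left₀ _ two_ne_zero] at hαγ
      exact (h.abs_kernel_le α γ hαγ).trans
        (le_mul_of_one_le_right h.bound_nonneg (one_le_weight _ _))

theorem isDominatedKernel_kernelDeriv (h : IsAdmissiblePair δ x y M) (hδ : 0 < δ) :
    IsDominatedKernel (torusLift (2 * π) (kernelDeriv x y)) (fun t => M * weight δ t) volume :=
  h.doublyPeriodic_kernelDeriv.isDominatedKernel_torusLift h.measurable_kernelDeriv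
    ((integrable_weight (NNReal.coe_pos.2 hδ)).const_mul M) fun α γ hαγ => by
      rw [weight_coe _ hαγ]
      rw [mul_div_cancel_left₀ _ two_ne_zero] at hαγ
      exact h.abs_kernelDeriv_le α γ hαγ

theorem isKernelDeriv (h : IsAdmissiblePair δ x y M) :
    IsKernelDeriv (torusLift (2 * π) (kernel x y)) (torusLift (2 * π) (kernelDeriv x y)) :=
  h.doublyPeriodic_kernel.isKernelDeriv_torusLift h.doublyPeriodic_kernelDeriv
    (fun α γ hαγ => hasDerivAt_kernel h.curve (h.sin_ne_zero α γ hαγ)) h.exists_tendsto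

theorem continuousAt_torusLift_kernel (h : IsAdmissiblePair δ x y M)
    (p : AddCircle (2 * π) × AddCircle (2 * π)) (hp : p.1 ≠ p.2) :
    ContinuousAt (Function.uncurry (torusLift (2 * π) (kernel x y))) p := by
  obtain ⟨⟨α⟩, ⟨γ⟩⟩ := p
  exact h.doublyPeriodic_kernel.continuousAt_torusLift
    (continuousAt_kernel h.curve h.continuous_right (h.sin_ne_zero α γ hp))

theorem continuousAt_torusLift_kernelDeriv (h : IsAdmissiblePair δ x y M)
    (p : AddCircle (2 * π) × AddCircle (2 * π)) (hp : p.1 ≠ p.2) :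
    ContinuousAt (Function.uncurry (torusLift (2 * π) (kernelDeriv x y))) p := by
  obtain ⟨⟨α⟩, ⟨γ⟩⟩ := p
  exact h.doublyPeriodic_kernelDeriv.continuousAt_torusLift
    (continuousAt_kernelDeriv h.curve h.continuous_right (h.sin_ne_zero α γ hp))

/-- The operator `u ↦ 2 BR(u, y)_x · ∂_α x` from `L²` to `H¹`. -/
noncomputable def operator (h : IsAdmissiblePair δ x y M) (hδ : 0 < δ) : L2 →L[ℝ] H1 :=
  (1 / π : ℝ) • (h.isDominatedKernel_kernel hδ).H1Operator (h.isDominatedKernel_kernelDeriv hδ)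
    h.isKernelDeriv

theorem isCompactOperator_operator (h : IsAdmissiblePair δ x y M) (hδ : 0 < δ) :
    IsCompactOperator (h.operator hδ) :=
  ((h.isDominatedKernel_kernel hδ).isCompactOperator_H1Operator (h.isDominatedKernel_kernelDeriv hδ)
    h.isKernelDeriv h.continuousAt_torusLift_kernel h.continuousAt_torusLift_kernelDeriv).smul
    (1 / π : ℝ)

theorem norm_operator_le (h : IsAdmissiblePair δ x y M) (hδ : 0 < δ) :
    ‖h.operator hδ‖ ≤ 2 / π * (∫ t : AddCircle (2 * π), weight δ t) * M := by
  have hnorm := (h.isDominatedKernel_kernel hδ).norm_H1Operator_le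
    (h.isDominatedKernel_kernelDeriv hδ) h.isKernelDeriv
  rw [integral_const_mul] at hnorm
  refine (ContinuousLinearMap.opNorm_smul_le _ _).trans ?_
  rw [Real.norm_of_nonneg (by positivity)]
  refine (mul_le_mul_of_nonneg_left hnorm (by positivity)).trans_eq ?_
  ring

theorem toL2_operator (h : IsAdmissiblePair δ x y M) (hδ : 0 < δ) (u : L2) :
    ∀ᵐ α : ℝ, H1.toL2 (h.operator hδ u) (α : AddCircle (2 * π)) = tangentialBR y x u α := by
  let A := (h.isDominatedKernel_kernel hδ).H1Operator (h.isDominatedKernel_kernelDeriv hδ)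
    h.isKernelDeriv
  have hA := (h.isDominatedKernel_kernel hδ).toL2_H1Operator (h.isDominatedKernel_kernelDeriv hδ)
    h.isKernelDeriv u
  filter_upwards [ae_coe_of_ae (Lp.coeFn_smul (1 / π : ℝ) (H1.toL2 (A u))), ae_coe_of_ae hA]
    with α hsmul hα
  calc H1.toL2 (h.operator hδ u) (α : AddCircle (2 * π))
      = 1 / π * ∫ c, torusLift (2 * π) (kernel x y) α c * u c := by rw [← hα]; exact hsmul
    _ = tangentialBR y x u α := by
        rw [tangentialBR, (h.hasPV u α).pv_eq, integral_addCircle_eq _ (-π) α,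
          show -π + 2 * π = π by ring]
        simp only [h.doublyPeriodic_kernel.torusLift_coe]

end IsAdmissiblePair

/-! ### Admissible pairs of curves -/

theorem kernel_self (x : ℝ → ℂ) (α : ℝ) : kernel x x α α = 0 := by
  simp [kernel, halfCot, Complex.cot_eq_cos_div_sin]

theorem kernelDeriv_self (x : ℝ → ℂ) (α : ℝ) : kernelDeriv x x α α = 0 := by
  simp [kernelDeriv, halfCot, halfCotDeriv, Complex.cot_eq_cos_div_sin]

theorem isAdmissiblePair_of_antilipschitz {δ s : ℝ≥0} {z : ℝ → ℂ} (hz : IsC2HolderCurve δ z)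
    (hδ : 0 < δ) (hs : AntilipschitzWith s z) :
    IsAdmissiblePair δ z z (9 * (s : ℝ) ^ 2 * curveNorm δ z ^ 2) where
  curve := hz
  continuous_right := hz.continuous
  add_two_pi_right := hz.periodic
  sin_ne_zero α γ hαγ := sin_half_sub_ne_zero hz.periodic fun m hm => hαγ <| by
    have hperiods : ((2 * π * m : ℝ) : AddCircle (2 * π)) = 0 :=
      (AddCircle.coe_eq_zero_iff (2 * π)).2 ⟨m, by rw [zsmul_eq_mul, mul_comm]⟩
    rw [hs.injective hm, AddCircle.coe_add, hperiods, add_zero]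
  abs_kernel_le α γ hαγ := by
    rcases eq_or_ne α γ with rfl | h
    · rw [kernel_self, abs_zero]
      positivity
    · exact abs_kernel_self_le hz hs hαγ h
  abs_kernelDeriv_le α γ hαγ := by
    rcases eq_or_ne α γ with rfl | h
    · rw [kernelDeriv_self, abs_zero]
      positivity
    · exact abs_kernelDeriv_self_le hz hs hαγ h
  exists_tendsto := exists_tendsto_kernel_self hz hδ hs
  exists_lower α := by
    have hs₀ : (0 : ℝ) < s := zero_lt_one.trans_le (one_le_of_antilipschitz hz.periodic hs)
    refine ⟨(s : ℝ)⁻¹, inv_pos.2 hs₀, fun β => ?_⟩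
    rw [inv_mul_le_iff₀ hs₀]
    simpa only [sub_sub_cancel] using abs_sub_le_of_antilipschitz hs α (α - β)
  exists_upper α := ⟨_, fun β => abs_im_deriv_div_sub_le hz hs α (α - β)⟩

section Separated

variable {y : ℝ → ℂ} {s : ℝ}

theorem exists_norm_sub_ofReal_le (hy : Continuous y)
    (hper : ∀ γ, y (γ + 2 * π) = y γ + 2 * π) : ∃ A, ∀ t : ℝ, ‖y t - t‖ ≤ A := by
  have hdrift : Function.Periodic (fun t : ℝ => y t - t) (2 * π) := fun t => by
    simp only [hper]
    push_cast
    ring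
  obtain ⟨A, hA⟩ := (hdrift.isBounded_of_continuous Real.two_pi_pos.ne'
    (hy.sub Complex.continuous_ofReal)).exists_norm_le
  exact ⟨A, fun t => hA _ ⟨t, rfl⟩⟩

theorem exists_mul_abs_le_norm_sub (hy : Continuous y)
    (hper : ∀ γ, y (γ + 2 * π) = y γ + 2 * π) (hs : 0 ≤ s) {a : ℂ}
    (hsep : ∀ γ, 1 ≤ s * ‖a - y γ‖) (α : ℝ) :
    ∃ c > 0, ∀ β, c * |β| ≤ ‖a - y (α - β)‖ := by
  obtain ⟨A, hA⟩ := exists_norm_sub_ofReal_le hy hper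
  have hA₀ : 0 ≤ A := (norm_nonneg _).trans (hA 0)
  set B := ‖a - α‖ + A
  refine ⟨(1 + B * s)⁻¹, by positivity, fun β => ?_⟩
  have hβ : |β| ≤ ‖a - y (α - β)‖ + B := by
    have hsplit : (β : ℂ) = a - y (α - β) - ((a - α) - (y (α - β) - ((α - β : ℝ) : ℂ))) := by
      push_cast
      ring
    rw [← Real.norm_eq_abs, ← Complex.norm_real, hsplit]
    exact (norm_sub_le _ _).trans
      (add_le_add_right ((norm_sub_le _ _).trans (add_le_add_right (hA _) _)) _)
  rw [inv_mul_le_iff₀ (by positivity)]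
  calc |β| ≤ ‖a - y (α - β)‖ + B * 1 := by rwa [mul_one]
    _ ≤ ‖a - y (α - β)‖ + B * (s * ‖a - y (α - β)‖) := by
        gcongr
        exact hsep (α - β)
    _ = (1 + B * s) * ‖a - y (α - β)‖ := by ring

theorem isAdmissiblePair_of_separated {δ : ℝ≥0} {x : ℝ → ℂ} (hx : IsC2HolderCurve δ x)
    (hy : Continuous y) (hper : ∀ γ, y (γ + 2 * π) = y γ + 2 * π) (hs : 1 ≤ s)
    (hsep : ∀ α γ, 1 ≤ s * ‖x α - y γ‖) :
    IsAdmissiblePair δ x y (9 * s ^ 2 * curveNorm δ x ^ 2) := by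
  have hne (α γ : ℝ) : x α - y γ ≠ 0 := fun h => by
    simpa only [h, norm_zero, mul_zero, not_le_of_gt zero_lt_one] using hsep α γ
  have hsin (α γ : ℝ) : Complex.sin ((x α - y γ) / 2) ≠ 0 :=
    sin_half_sub_ne_zero hper fun m => sub_ne_zero.1 (hne _ _)
  exact
    { curve := hx
      continuous_right := hy
      add_two_pi_right := hper
      sin_ne_zero := fun α γ _ => hsin α γ
      abs_kernel_le := fun α γ _ => BirkhoffRott.abs_kernel_le hx hper hs (hsep α)
      abs_kernelDeriv_le := fun α γ _ =>
        (BirkhoffRott.abs_kernelDeriv_le hx hper hs (hsep α)).trans <|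
          le_mul_of_one_le_right (by positivity) <|
            le_add_of_nonneg_right <| Real.rpow_nonneg (abs_nonneg _) _
      exists_tendsto := fun γ => ⟨kernel x y γ γ,
        (hasDerivAt_kernel hx (hsin γ γ)).continuousAt.tendsto.mono_left nhdsWithin_le_nhds⟩
      exists_lower := fun α =>
        exists_mul_abs_le_norm_sub hy hper (zero_le_one.trans hs) (hsep α) α
      exists_upper := fun α => ⟨curveNorm δ x * s, fun β => by
        refine (Complex.abs_im_le_norm _).trans ?_
        rw [norm_div, div_le_iff₀ (norm_pos_iff.2 (hne α (α - β))), mul_assoc]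
        exact (hx.norm_deriv_le α).trans (le_mul_of_one_le_right hx.curveNorm_nonneg (hsep _ _))⟩ }

end Separated

/-! ### The arc-chord and distance functions -/

theorem antilipschitzWith_of_arcChordNorm_lt_top {z : ℝ → ℂ} (hF : arcChordNorm z < ⊤) :
    AntilipschitzWith (NNReal.sqrt (arcChordNorm z).toNNReal) z := by
  refine AntilipschitzWith.of_le_mul_dist fun α γ => ?_
  rcases eq_or_ne α γ with rfl | h
  · simp
  have hchord : arcChord z α (α - γ) ≤ arcChordNorm z :=
    (le_iSup (fun β => arcChord z α β) (α - γ)).trans (le_iSup (fun α => ⨆ β, arcChord z α β) α)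
  rw [arcChord, if_neg (sub_ne_zero.2 h), sub_sub_cancel,
    ENNReal.div_le_iff_le_mul (Or.inr hF.ne) (Or.inl (by simp))] at hchord
  have hreal := ENNReal.toReal_mono (ENNReal.mul_ne_top hF.ne (by simp)) hchord
  rw [ENNReal.toReal_mul, ENNReal.toReal_pow, ENNReal.toReal_pow, toReal_enorm, toReal_enorm]
    at hreal
  rw [dist_eq_norm, dist_eq_norm, Real.coe_sqrt]
  refine le_of_sq_le_sq ?_ (by positivity)
  rwa [mul_pow, Real.sq_sqrt NNReal.zero_le_coe]

theorem one_le_sqrt_distNorm_mul_norm_sub {z h : ℝ → ℂ} (hd : distNorm z h < ⊤) (α γ : ℝ) :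
    1 ≤ √(max 1 (distNorm z h).toReal) * ‖z α - h γ‖ := by
  have hdist : (‖z α - h (α - (α - γ))‖ₑ ^ 2)⁻¹ ≤ distNorm z h :=
    (le_iSup (fun β => (‖z α - h (α - β)‖ₑ ^ 2)⁻¹) (α - γ)).trans
      (le_iSup (fun α => ⨆ β, (‖z α - h (α - β)‖ₑ ^ 2)⁻¹) α)
  rw [sub_sub_cancel, ← one_div, ENNReal.div_le_iff_le_mul (Or.inr hd.ne) (Or.inl (by simp))]
    at hdist
  have hreal := ENNReal.toReal_mono (ENNReal.mul_ne_top hd.ne (by simp)) hdist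
  rw [ENNReal.toReal_mul, ENNReal.toReal_pow, toReal_enorm, ENNReal.toReal_one] at hreal
  refine le_of_sq_le_sq ?_ (by positivity)
  rw [one_pow, mul_pow, Real.sq_sqrt (zero_le_one.trans (le_max_left _ _))]
  exact hreal.trans (by gcongr; exact le_max_right _ _)

theorem isAdmissiblePair_self {δ : ℝ≥0} {z : ℝ → ℂ} (hz : IsC2HolderCurve δ z) (hδ : 0 < δ)
    (hF : arcChordNorm z < ⊤) :
    IsAdmissiblePair δ z z (9 * (arcChordNorm z).toReal * curveNorm δ z ^ 2) := by
  have hself :=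
    isAdmissiblePair_of_antilipschitz hz hδ (antilipschitzWith_of_arcChordNorm_lt_top hF)
  rwa [Real.coe_sqrt, Real.sq_sqrt NNReal.zero_le_coe] at hself

theorem one_le_arcChordNorm {z : ℝ → ℂ} (hz : ∀ α, z (α + 2 * π) = z α + 2 * π)
    (hF : arcChordNorm z < ⊤) : 1 ≤ (arcChordNorm z).toReal := by
  have hsqrt := one_le_of_antilipschitz hz (antilipschitzWith_of_arcChordNorm_lt_top hF)
  rwa [Real.coe_sqrt, Real.one_le_sqrt] at hsqrt

/-! ### The matrix operator -/

section MatrixOperator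

variable {δ : ℝ≥0} {z h : ℝ → ℂ} {M₁ M₂ M₃ M₄ : ℝ}

theorem operatorsDefined (h₁ : IsAdmissiblePair δ z z M₁) (h₂ : IsAdmissiblePair δ z h M₂)
    (h₃ : IsAdmissiblePair δ h z M₃) (h₄ : IsAdmissiblePair δ h h M₄) : OperatorsDefined z h :=
  fun u α => ⟨⟨_, h₁.hasPV u α⟩, ⟨_, h₂.hasPV u α⟩, ⟨_, h₃.hasPV u α⟩, ⟨_, h₄.hasPV u α⟩⟩

theorem ae_toL2_add (f g : H1) :
    ∀ᵐ α : ℝ, H1.toL2 (f + g) (α : AddCircle (2 * π)) = H1.toL2 f α + H1.toL2 g α :=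
  ae_coe_of_ae (Lp.coeFn_add (H1.toL2 f) (H1.toL2 g))

theorem isMatrixOperator_matrixOperator (hδ : 0 < δ) (h₁ : IsAdmissiblePair δ z z M₁)
    (h₂ : IsAdmissiblePair δ z h M₂) (h₃ : IsAdmissiblePair δ h z M₃)
    (h₄ : IsAdmissiblePair δ h h M₄) :
    IsMatrixOperator z h (matrixOperator (h₁.operator hδ) (h₂.operator hδ) (h₃.operator hδ)
      (h₄.operator hδ)) := fun w => by
  filter_upwards [h₁.toL2_operator hδ w.fst, h₂.toL2_operator hδ w.snd,
    h₃.toL2_operator hδ w.fst, h₄.toL2_operator hδ w.snd,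
    ae_toL2_add (h₁.operator hδ w.fst) (h₂.operator hδ w.snd),
    ae_toL2_add (h₃.operator hδ w.fst) (h₄.operator hδ w.snd)] with α e₁ e₂ e₃ e₄ hfst hsnd
  exact ⟨hfst.trans (congrArg₂ (· + ·) e₁ e₂), hsnd.trans (congrArg₂ (· + ·) e₃ e₄)⟩

theorem norm_matrixOperator_operator_le (hδ : 0 < δ) (h₁ : IsAdmissiblePair δ z z M₁)
    (h₂ : IsAdmissiblePair δ z h M₂) (h₃ : IsAdmissiblePair δ h z M₃)
    (h₄ : IsAdmissiblePair δ h h M₄) :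
    ‖matrixOperator (h₁.operator hδ) (h₂.operator hδ) (h₃.operator hδ) (h₄.operator hδ)‖ ≤
      2 / π * (∫ t : AddCircle (2 * π), weight δ t) * (M₁ + M₂ + M₃ + M₄) := by
  refine (norm_matrixOperator_le _ _ _ _).trans ?_
  simp only [mul_add]
  exact add_le_add (add_le_add (add_le_add (h₁.norm_operator_le hδ) (h₂.norm_operator_le hδ))
    (h₃.norm_operator_le hδ)) (h₄.norm_operator_le hδ)

end MatrixOperator

theorem exists_isMatrixOperator_norm_le {δ : ℝ≥0} (hδ : 0 < δ) {z h : ℝ → ℂ}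
    (hz : IsC2HolderCurve δ z) (hh : IsC2HolderCurve δ h) (hFz : arcChordNorm z < ⊤)
    (hFh : arcChordNorm h < ⊤) (hd : distNorm z h < ⊤) :
    OperatorsDefined z h ∧ ∃ S : L2Pair →L[ℝ] H1Pair, IsMatrixOperator z h S ∧
      IsCompactOperator S ∧ ‖S‖ ≤ 18 / π * (∫ t : AddCircle (2 * π), weight δ t) *
        (((arcChordNorm z).toReal + max 1 (distNorm z h).toReal) * (c2HolderNorm δ z).toReal ^ 2 +
          (max 1 (distNorm z h).toReal + (arcChordNorm h).toReal) *
            (c2HolderNorm δ h).toReal ^ 2) := by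
  have hD : 1 ≤ max 1 (distNorm z h).toReal := le_max_left _ _
  have hsep := one_le_sqrt_distNorm_mul_norm_sub hd
  have h₁ := isAdmissiblePair_self hz hδ hFz
  have h₂ := isAdmissiblePair_of_separated hz hh.continuous hh.periodic (Real.one_le_sqrt.2 hD)
    hsep
  have h₃ := isAdmissiblePair_of_separated hh hz.continuous hz.periodic (Real.one_le_sqrt.2 hD)
    fun α γ => by simpa only [norm_sub_rev] using hsep γ α
  have h₄ := isAdmissiblePair_self hh hδ hFh
  refine ⟨operatorsDefined h₁ h₂ h₃ h₄, _, isMatrixOperator_matrixOperator hδ h₁ h₂ h₃ h₄,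
    isCompactOperator_matrixOperator (h₁.isCompactOperator_operator hδ)
      (h₂.isCompactOperator_operator hδ) (h₃.isCompactOperator_operator hδ)
      (h₄.isCompactOperator_operator hδ),
    (norm_matrixOperator_operator_le hδ h₁ h₂ h₃ h₄).trans_eq ?_⟩
  rw [Real.sq_sqrt (zero_le_one.trans hD), curveNorm, curveNorm]
  ring

theorem integral_weight_pos {δ : ℝ≥0} (hδ : 0 < δ) :
    0 < ∫ t : AddCircle (2 * π), weight δ t := by
  have hone := integral_mono (integrable_const (1 : ℝ))
    (integrable_weight (T := 2 * π) (NNReal.coe_pos.2 hδ)) (one_le_weight (δ : ℝ))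
  rw [integral_const, smul_eq_mul, mul_one, measureReal_def, AddCircle.measure_univ,
    ENNReal.toReal_ofReal Real.two_pi_pos.le] at hone
  exact Real.two_pi_pos.trans_le hone

theorem add_mul_sq_add_add_mul_sq_le {F D N G H : ℝ} (hF : 1 ≤ F) (hD : 1 ≤ D) (hN : 1 ≤ N)
    (hG : 0 ≤ G) :
    (F + D) * N ^ 2 + (D + G) * H ^ 2 ≤
      (2 + (1 + G) * H ^ 2) * (F ^ 2 * D ^ 2 * N ^ 4) := by
  have hF₂ : F ≤ F ^ 2 * D ^ 2 :=
    (le_self_pow₀ hF two_ne_zero).trans (le_mul_of_one_le_right (by positivity) (one_le_pow₀ hD))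
  have hD₂ : D ≤ F ^ 2 * D ^ 2 :=
    (le_self_pow₀ hD two_ne_zero).trans (le_mul_of_one_le_left (by positivity) (one_le_pow₀ hF))
  have hN₂ : N ^ 2 ≤ N ^ 4 := pow_le_pow_right₀ hN (by norm_num)
  have hDG : D + G ≤ F ^ 2 * D ^ 2 * N ^ 4 * (1 + G) := by
    have hQ : F ^ 2 * D ^ 2 ≤ F ^ 2 * D ^ 2 * N ^ 4 :=
      le_mul_of_one_le_right (by positivity) (one_le_pow₀ hN)
    nlinarith
  calc (F + D) * N ^ 2 + (D + G) * H ^ 2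
      ≤ (F ^ 2 * D ^ 2 + F ^ 2 * D ^ 2) * N ^ 4 + F ^ 2 * D ^ 2 * N ^ 4 * (1 + G) * H ^ 2 := by
        gcongr
    _ = (2 + (1 + G) * H ^ 2) * (F ^ 2 * D ^ 2 * N ^ 4) := by ring

theorem mainTheorem5_general {δ : ℝ≥0} (hδ : 0 < δ) {z h : ℝ → ℂ} (hz : IsC2HolderCurve δ z)
    (hh : IsC2HolderCurve δ h) (hFz : arcChordNorm z < ⊤) (hFh : arcChordNorm h < ⊤)
    (hd : distNorm z h < ⊤) :
    OperatorsDefined z h ∧ ∃ S : L2Pair →L[ℝ] H1Pair, IsMatrixOperator z h S ∧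
      IsCompactOperator S ∧ ‖S‖ ≤ 18 / π * (∫ t : AddCircle (2 * π), weight δ t) *
        (2 + (1 + (arcChordNorm h).toReal) * (c2HolderNorm δ h).toReal ^ 2) *
        (arcChordNorm z).toReal ^ 2 * (max 1 (distNorm z h).toReal) ^ 2 *
        (c2HolderNorm δ z).toReal ^ 4 := by
  obtain ⟨hdef, S, hS, hcompact, hnorm⟩ := exists_isMatrixOperator_norm_le hδ hz hh hFz hFh hd
  have hbound := add_mul_sq_add_add_mul_sq_le (G := (arcChordNorm h).toReal)
    (H := (c2HolderNorm δ h).toReal) (one_le_arcChordNorm hz.periodic hFz)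
    (le_max_left 1 (distNorm z h).toReal) hz.one_le_curveNorm ENNReal.toReal_nonneg
  have hW : 0 ≤ 18 / π * ∫ t : AddCircle (2 * π), weight δ t :=
    mul_nonneg (by positivity) (integral_weight_pos hδ).le
  refine ⟨hdef, S, hS, hcompact, hnorm.trans <|
    (mul_le_mul_of_nonneg_left hbound hW).trans_eq ?_⟩
  rw [curveNorm]
  ring

end BirkhoffRott

theorem mainTheorem5 (δ : ℝ≥0) (hδ₀ : 0 < δ) (hδ₁ : δ ≤ 1)
    (h : ℝ → ℂ) (hh : BirkhoffRott.IsC2HolderCurve δ h)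
    (hFh : BirkhoffRott.arcChordNorm h < ⊤) :
    ∃ C : ℝ, 0 < C ∧
      ∀ z : ℝ → ℂ, BirkhoffRott.IsC2HolderCurve δ z → BirkhoffRott.arcChordNorm z < ⊤ →
        BirkhoffRott.distNorm z h < ⊤ →
        BirkhoffRott.OperatorsDefined z h ∧
        ∃ S : BirkhoffRott.L2Pair →L[ℝ] BirkhoffRott.H1Pair,
          BirkhoffRott.IsMatrixOperator z h S ∧ IsCompactOperator S ∧
          ‖S‖ ≤ C * (BirkhoffRott.arcChordNorm z).toReal ^ 2
            * (max 1 (BirkhoffRott.distNorm z h).toReal) ^ 2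
            * (BirkhoffRott.c2HolderNorm δ z).toReal ^ 4 := by
  have hW := BirkhoffRott.integral_weight_pos hδ₀
  exact ⟨_, by positivity, fun z hz hFz hd =>
    BirkhoffRott.mainTheorem5_general hδ₀ hz hh hFz hFh hd⟩
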